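/- Let $\mathcal C\subset[0,1]$ be the classical ternary Cantor set and $s=\frac{\log 2}{\log 3}$. For $0<\alpha<1$ define $\psi^\alpha_c:\mathbb R\to\mathbb R$ by $\psi^\alpha_c(x_1)=d(x_1,\mathcal C)^\alpha$ for $x_1\in(0,1)$ and $\psi^\alpha_c(x_1)=0$ otherwise, and put $$\Omega^+=\{(x_1,x_2)\in\mathbb R^2: x_2>\psi^\alpha_c(x_1)\},\qquad \Omega^-=\{(x_1,x_2)\in\mathbb R^2: x_2<\psi^\alpha_c(x_1)\}.$$ For an open set $\Omega\subset\mathbb R^2$ and $1\le p\le\infty$, $W^{1,p}(\Omega)$ is the set of all $u\in L^p(\Omega)$ that have a weak derivative $Du$ on $\Omega$ with $|Du|\in L^p(\Omega)$; $W^{1,q}_{\rm loc}(\mathbb R^2)$ is the set of functions that belong to $W^{1,q}(U)$ for every bounded open $U\subset\mathbb R^2$. An extension of $u\in W^{1,p}(\Omega)$ in the class $W^{1,q}_{\rm loc}(\mathbb R^2)$ is a function in $W^{1,q}_{\rm loc}(\mathbb R^2)$ that coincides with $u$ almost everywhere on $\Omega$. (1) Let $0<\alpha\le\frac{\log 2}{2\log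 3}$. Then for every $1\le p\le\infty$ there exist functions $u^-\in W^{1,p}(\Omega^-)$ and $u^+\in W^{1,p}(\Omega^+)$ which do not have extensions in the class $W^{1,1}_{\rm loc}(\mathbb R^2)$. (2) Let $\frac{\log 2}{2\log 3}<\alpha<1$. Then for every $1\le p\le\frac{1+\alpha-s}{2\alpha-s}$ there exist functions $u^-\in W^{1,p}(\Omega^-)$ and $u^+\in W^{1,p}(\Omega^+)$ which do not have extensions in the class $W^{1,1}_{\rm loc}(\mathbb R^2)$. (3) Let $\frac{\log 2}{2\log 3}<\alpha<1$. Then for every $\frac{1+\alpha-s}{2\alpha-s}<p<\infty$ and every $\frac{(1+\alpha-s)p}{(1+\alpha-s)+(1-\alpha)p}\le q<\infty$ there exist functions $u^-\in W^{1,p}(\Omega^-)$ and $u^+\in W^{1,p}(\Omega^+)$ which do not have extensions in the class $W^{1,q}_{\rm loc}(\mathbb R^2)$. -/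

import Mathlib

open MeasureTheory Set
open scoped ENNReal ContDiff

/-! Points of the plane are pairs `(x₁, x₂) : ℝ × ℝ`; `volume` is Lebesgue measure.  None of the
notions below depends on the choice of a norm on the plane. -/

/-- `v = (v₁, v₂)` is the weak derivative of `u` on the open set `Ω`: both are locally integrable
on `Ω`, and `∫_Ω η v = - ∫_Ω u Dη` (written in components) for every `η ∈ C_c^∞(Ω)`. -/
structure HasWeakGradientOn (Ω : Set (ℝ × ℝ)) (u : ℝ × ℝ → ℝ) (v : ℝ × ℝ → ℝ × ℝ) : Prop where
  locInt : LocallyIntegrableOn u Ω volume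
  locInt_grad : LocallyIntegrableOn v Ω volume
  fst : ∀ η : ℝ × ℝ → ℝ, ContDiff ℝ ∞ η → HasCompactSupport η → tsupport η ⊆ Ω →
    ∫ x in Ω, η x * (v x).1 = - ∫ x in Ω, u x * fderiv ℝ η x (1, 0)
  snd : ∀ η : ℝ × ℝ → ℝ, ContDiff ℝ ∞ η → HasCompactSupport η → tsupport η ⊆ Ω →
    ∫ x in Ω, η x * (v x).2 = - ∫ x in Ω, u x * fderiv ℝ η x (0, 1)

/-- `u ∈ W^{1,p}(Ω)`: `u ∈ L^p(Ω)`, and `u` has a weak derivative `Du` on `Ω` with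
`|Du| ∈ L^p(Ω)`.  (`MemLp v p` for a plane-valued `v` says that `v` is a.e. measurable and that
its norm is in `L^p`; all norms on the plane being equivalent, this is `|v| ∈ L^p`.)
Only the values of `u` on `Ω` matter. -/
def MemW1 (p : ℝ≥0∞) (Ω : Set (ℝ × ℝ)) (u : ℝ × ℝ → ℝ) : Prop :=
  MemLp u p (volume.restrict Ω) ∧
    ∃ v : ℝ × ℝ → ℝ × ℝ, HasWeakGradientOn Ω u v ∧ MemLp v p (volume.restrict Ω)

/-- `u ∈ W^{1,p}_loc(Ω)`: `u ∈ W^{1,p}(U)` for every bounded open `U` whose closure lies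
in `Ω`. -/
def MemW1Loc (p : ℝ≥0∞) (Ω : Set (ℝ × ℝ)) (u : ℝ × ℝ → ℝ) : Prop :=
  ∀ U : Set (ℝ × ℝ), IsOpen U → Bornology.IsBounded U → closure U ⊆ Ω → MemW1 p U u

/-- `u`, a function on `Ω`, has an extension in the class `W^{1,q}_loc(ℝ²)`: some
`w ∈ W^{1,q}_loc(ℝ²)` coincides with `u` almost everywhere on `Ω`. -/
def HasW1LocExtension (q : ℝ≥0∞) (Ω : Set (ℝ × ℝ)) (u : ℝ × ℝ → ℝ) : Prop :=
  ∃ w : ℝ × ℝ → ℝ, MemW1Loc q univ w ∧ w =ᵐ[volume.restrict Ω] u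

/-- The function `ψ(x) = d(x, 𝒞)^α` for `x ∈ (0, 1)` and `ψ(x) = 0` for all other real `x`,
where `𝒞` is the ternary Cantor set. -/
noncomputable def cantorPsi (α x : ℝ) : ℝ :=
  open Classical in if x ∈ Ioo (0 : ℝ) 1 then (Metric.infDist x cantorSet) ^ α else 0

/-- The domain above the graph of `ψ`. -/
def cantorUpper (α : ℝ) : Set (ℝ × ℝ) := {x | cantorPsi α x.1 < x.2}

/-- The domain below the graph of `ψ`. -/
def cantorLower (α : ℝ) : Set (ℝ × ℝ) := {x | x.2 < cantorPsi α x.1}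

/-- `log 2 / log 3`, the Hausdorff dimension of the ternary Cantor set. -/
noncomputable def cantorDim : ℝ := Real.log 2 / Real.log 3

/-!
Near each of the `2 ^ k` intervals of generation `k`, a horizontal line at height `~ 3 ^ (-α k)`
leaves the domain and enters it again. There the `k`-th term of a sum of layers
`a k * φ (y / 3 ^ (-α k))`, each restricted to suitable blocks, may jump without being singular in
the domain. As the layers have disjoint supports, their sum `u` is in `W^{1,p}` as soon as
`∑ 3 ^ (-(1 + α - s) k) * (a k * 3 ^ (α k)) ^ p` converges. An extension must make up for each jump
of size `a k` within a horizontal distance `~ 3 ^ (-k)`, so by Jensen's inequality its gradient in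
`L^q` forces `∑ 3 ^ (-(1 + α - s) k) * (a k * 3 ^ k) ^ q` to converge. For
`a k = 3 ^ (-γ k) * (k + 1) ^ (-1 / q)` with `γ = 1 - (1 + α - s) / q` the latter is the harmonic
series.
-/

open scoped Topology Function

section WeakGradient

theorem integrable_mul_of_tsupport_subset {X : Type*} [TopologicalSpace X] [MeasurableSpace X]
    [OpensMeasurableSpace X] [T2Space X] {μ : Measure X} {Ω : Set X} {u η : X → ℝ}
    (hu : LocallyIntegrableOn u Ω μ) (hη : Continuous η) (hc : HasCompactSupport η)
    (hs : tsupport η ⊆ Ω) : Integrable (fun z => u z * η z) μ := by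
  have hsupp : Function.support (fun z => u z * η z) ⊆ tsupport η := fun z hz =>
    subset_tsupport η (right_ne_zero_of_mul hz)
  rw [← integrableOn_iff_integrable_of_support_subset hsupp]
  exact (hu.integrableOn_compact_subset hs hc).mul_continuousOn hη.continuousOn hc

theorem setIntegral_mul_eq_neg_of_hasLineDerivAt {E : Type*} [NormedAddCommGroup E]
    [NormedSpace ℝ E] [MeasurableSpace E] [BorelSpace E] [FiniteDimensional ℝ E] {μ : Measure E}
    [μ.IsAddHaarMeasure] {Ω : Set E} {u g η : E → ℝ} {e : E}
    (hu : LocallyIntegrableOn u Ω μ) (hg : LocallyIntegrableOn g Ω μ)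
    (h : ∀ z ∈ Ω, HasLineDerivAt ℝ u (g z) z e) (hη : ContDiff ℝ 1 η)
    (hc : HasCompactSupport η) (hs : tsupport η ⊆ Ω) :
    ∫ z in Ω, η z * g z ∂μ = -∫ z in Ω, u z * fderiv ℝ η z e ∂μ := by
  have hη' : Continuous fun z => fderiv ℝ η z e :=
    (hη.continuous_fderiv one_ne_zero).clm_apply continuous_const
  have hs' : tsupport (fun z => fderiv ℝ η z e) ⊆ tsupport η := tsupport_fderiv_apply_subset ℝ e
  have parts := integral_bilinear_hasLineDerivAt_right_eq_neg_left_of_integrable (v := e)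
    (B := ContinuousLinearMap.mul ℝ ℝ)
    (integrable_mul_of_tsupport_subset hg hη.continuous hc hs)
    (integrable_mul_of_tsupport_subset hu hη' (hc.fderiv_apply ℝ e)
      (hs'.trans hs))
    (integrable_mul_of_tsupport_subset hu hη.continuous hc hs) (fun z hz => h z (hs hz))
    (fun z _ => (hη.differentiable one_ne_zero z).hasFDerivAt.hasLineDerivAt e)
  rw [setIntegral_eq_integral_of_forall_compl_eq_zero fun z hz => ?_,
    setIntegral_eq_integral_of_forall_compl_eq_zero fun z hz => ?_]
  · simpa only [ContinuousLinearMap.mul_apply', mul_comm, neg_eq_iff_eq_neg, eq_comm] using parts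
  · rw [image_eq_zero_of_notMem_tsupport fun hz' => hz (hs (hs' hz')), mul_zero]
  · rw [image_eq_zero_of_notMem_tsupport fun hz' => hz (hs hz'), zero_mul]

theorem hasWeakGradientOn_of_hasLineDerivAt {Ω : Set (ℝ × ℝ)} {u : ℝ × ℝ → ℝ}
    {v : ℝ × ℝ → ℝ × ℝ} (hu : LocallyIntegrableOn u Ω) (hv : LocallyIntegrableOn v Ω)
    (h₁ : ∀ z ∈ Ω, HasLineDerivAt ℝ u (v z).1 z (1, 0))
    (h₂ : ∀ z ∈ Ω, HasLineDerivAt ℝ u (v z).2 z (0, 1)) : HasWeakGradientOn Ω u v where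
  locInt := hu
  locInt_grad := hv
  fst _η hη hc hs := setIntegral_mul_eq_neg_of_hasLineDerivAt hu
    (fun z hz => (hv z hz).imp fun _ ht => ⟨ht.1, ht.2.fst⟩) h₁ (hη.of_le (by simp)) hc hs
  snd _η hη hc hs := setIntegral_mul_eq_neg_of_hasLineDerivAt hu
    (fun z hz => (hv z hz).imp fun _ ht => ⟨ht.1, ht.2.snd⟩) h₂ (hη.of_le (by simp)) hc hs

theorem hasLineDerivAt_fst {u : ℝ × ℝ → ℝ} {u' : ℝ} {z : ℝ × ℝ}
    (h : HasDerivAt (fun x => u (x, z.2)) u' z.1) : HasLineDerivAt ℝ u u' z (1, 0) := by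
  simpa [HasLineDerivAt, Prod.add_def] using
    HasDerivAt.comp_const_add (a := z.1) 0 (by simpa using h)

theorem hasLineDerivAt_snd {u : ℝ × ℝ → ℝ} {u' : ℝ} {z : ℝ × ℝ}
    (h : HasDerivAt (fun y => u (z.1, y)) u' z.2) : HasLineDerivAt ℝ u u' z (0, 1) := by
  simpa [HasLineDerivAt, Prod.add_def] using
    HasDerivAt.comp_const_add (a := z.2) 0 (by simpa using h)

end WeakGradient

section Jump

theorem fderiv_mul_prod_fst {f g : ℝ → ℝ} {z : ℝ × ℝ} (hf : DifferentiableAt ℝ f z.1)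
    (hg : DifferentiableAt ℝ g z.2) :
    fderiv ℝ (fun z : ℝ × ℝ => f z.1 * g z.2) z (1, 0) = deriv f z.1 * g z.2 := by
  have hf' := hf.hasDerivAt.comp_hasFDerivAt z (hasFDerivAt_fst (𝕜 := ℝ) (p := z))
  have hg' := hg.hasDerivAt.comp_hasFDerivAt z (hasFDerivAt_snd (𝕜 := ℝ) (p := z))
  have := (hf'.mul hg').fderiv
  simp_all [Function.comp_def, Pi.mul_def, mul_comm]

theorem integral_Iio_deriv_contDiffBump {c : ℝ} (θ : ContDiffBump c) :
    ∫ x in Iio c, deriv θ x = 1 := by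
  rw [← integral_Iic_eq_integral_Iio,
    HasCompactSupport.integral_Iic_deriv_eq θ.contDiff θ.hasCompactSupport,
    θ.one_of_mem_closedBall (Metric.mem_closedBall_self θ.rIn_pos.le)]

theorem dist_mem_Icc_of_deriv_contDiffBump_ne_zero {c x : ℝ} {θ : ContDiffBump c}
    (h : deriv θ x ≠ 0) : dist x c ∈ Icc θ.rIn θ.rOut := by
  constructor <;> refine le_of_not_gt fun hx => h ?_
  · have : θ =ᶠ[𝓝 x] fun _ => 1 := by
      filter_upwards [Metric.isOpen_ball.mem_nhds hx] with y hy using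
        θ.one_of_mem_closedBall (Metric.ball_subset_closedBall hy)
    rw [this.deriv_eq, deriv_const]
  · refine image_eq_zero_of_notMem_tsupport fun hx' => hx.not_ge ?_
    simpa only [θ.tsupport_eq, Metric.mem_closedBall] using tsupport_deriv_subset hx'

theorem tsupport_mul_prod_subset {f g : ℝ → ℝ} :
    tsupport (fun z : ℝ × ℝ => f z.1 * g z.2) ⊆ tsupport f ×ˢ tsupport g :=
  closure_minimal (fun _ hz => ⟨subset_tsupport f (left_ne_zero_of_mul hz),
    subset_tsupport g (right_ne_zero_of_mul hz)⟩) ((isClosed_tsupport f).prod (isClosed_tsupport g))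

variable {U : Set (ℝ × ℝ)} {w : ℝ × ℝ → ℝ} {v : ℝ × ℝ → ℝ × ℝ} {c : ℝ} {θ : ContDiffBump c}
  {ψ g : ℝ → ℝ}

theorem setIntegral_mul_deriv_mul_eq_of_jump
    (hU : Metric.closedBall c θ.rOut ×ˢ tsupport ψ ⊆ U)
    (hjump : ∀ᵐ z, deriv θ z.1 ≠ 0 → ψ z.2 ≠ 0 →
      w z = (Iio c).indicator (fun _ => g z.2) z.1) :
    ∫ z in U, w z * (deriv θ z.1 * ψ z.2) = ∫ y, g y * ψ y := by
  have hsupp : ∀ z ∉ U, w z * (deriv θ z.1 * ψ z.2) = 0 := by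
    intro z hz
    by_contra h
    exact hz (hU ⟨(dist_mem_Icc_of_deriv_contDiffBump_ne_zero
      (left_ne_zero_of_mul (right_ne_zero_of_mul h))).2,
      subset_tsupport ψ (right_ne_zero_of_mul (right_ne_zero_of_mul h))⟩)
  have hsplit : ∀ᵐ z : ℝ × ℝ, w z * (deriv θ z.1 * ψ z.2) =
      (Iio c).indicator (deriv θ) z.1 * (g z.2 * ψ z.2) := by
    filter_upwards [hjump] with z hz
    by_cases h₁ : deriv θ z.1 = 0
    · simp [h₁, indicator_apply]
    by_cases h₂ : ψ z.2 = 0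
    · simp [h₂]
    rw [hz h₁ h₂]
    by_cases hc : z.1 ∈ Iio c
    · simp only [indicator_of_mem hc]; ring
    · simp only [indicator_of_notMem hc, zero_mul]
  rw [setIntegral_eq_integral_of_forall_compl_eq_zero hsupp, integral_congr_ae hsplit,
    Measure.volume_eq_prod, integral_prod_mul ((Iio c).indicator (deriv θ)) (fun y => g y * ψ y),
    integral_indicator measurableSet_Iio, integral_Iio_deriv_contDiffBump, one_mul]

theorem enorm_integral_le_lintegral_of_jump (hw : HasWeakGradientOn U w v)
    (hψ : ContDiff ℝ ∞ ψ) (hψc : HasCompactSupport ψ) (hψ1 : ∀ y, |ψ y| ≤ 1)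
    (hU : Metric.closedBall c θ.rOut ×ˢ tsupport ψ ⊆ U)
    (hjump : ∀ᵐ z, deriv θ z.1 ≠ 0 → ψ z.2 ≠ 0 →
      w z = (Iio c).indicator (fun _ => g z.2) z.1) :
    ‖∫ y, g y * ψ y‖ₑ ≤
      ∫⁻ z in Metric.ball c θ.rOut ×ˢ Function.support ψ, ‖v z‖ₑ := by
  set η : ℝ × ℝ → ℝ := fun z => θ z.1 * ψ z.2
  have hη : ContDiff ℝ ∞ η := (θ.contDiff.comp contDiff_fst).mul (hψ.comp contDiff_snd)
  have hηs : tsupport η ⊆ Metric.closedBall c θ.rOut ×ˢ tsupport ψ := by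
    simpa only [θ.tsupport_eq] using tsupport_mul_prod_subset (f := θ) (g := ψ)
  have hηc : HasCompactSupport η :=
    ((isCompact_closedBall c θ.rOut).prod hψc).of_isClosed_subset (isClosed_tsupport η) hηs
  have hη_supp : Function.support η = Metric.ball c θ.rOut ×ˢ Function.support ψ := by
    ext z; simp [η, ← θ.support_eq]
  have htest : ∫ z in U, η z * (v z).1 = -∫ y, g y * ψ y := by
    rw [hw.fst η hη hηc (hηs.trans hU), ← setIntegral_mul_deriv_mul_eq_of_jump hU hjump]
    simp only [η, fderiv_mul_prod_fst (θ.contDiff (n := 1).differentiable one_ne_zero _)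
      (hψ.differentiable (by simp) _)]
  have hbound : ∀ z, ‖η z * (v z).1‖ₑ ≤ (Function.support η).indicator (fun z => ‖v z‖ₑ) z := by
    intro z
    by_cases hz : η z = 0
    · simp [hz]
    rw [indicator_of_mem (Function.mem_support.2 hz), enorm_le_iff_norm_le]
    have hη1 : ‖η z‖ ≤ 1 := by
      rw [norm_mul, Real.norm_of_nonneg θ.nonneg]
      exact mul_le_one₀ θ.le_one (norm_nonneg _) (hψ1 z.2)
    exact (norm_mul_le_of_le hη1 (norm_fst_le (v z))).trans_eq (one_mul _)
  calc ‖∫ y, g y * ψ y‖ₑ = ‖∫ z in U, η z * (v z).1‖ₑ := by rw [htest, enorm_neg]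
    _ ≤ ∫⁻ z in U, ‖η z * (v z).1‖ₑ := enorm_integral_le_lintegral_enorm _
    _ ≤ ∫⁻ z, (Function.support η).indicator (fun z => ‖v z‖ₑ) z :=
      (setLIntegral_le_lintegral _ _).trans (lintegral_mono hbound)
    _ = ∫⁻ z in Metric.ball c θ.rOut ×ˢ Function.support ψ, ‖v z‖ₑ := by
      rw [lintegral_indicator hη.continuous.isOpen_support.measurableSet, hη_supp]

end Jump

section Pieces

variable {X ι E F : Type*} [MeasurableSpace X] [Countable ι] {μ : Measure X} {S : ι → Set X}
  [NormedAddCommGroup E]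

theorem map_restrict_iUnion_le_of_eqOn [MeasurableSpace ι] [MeasurableSingletonClass ι]
    {ν : Measure ι} {idx : X → ι} (hidx : Measurable idx) (hS : ∀ i, ∀ x ∈ S i, idx x = i)
    (hν : ∀ i, μ (S i) ≤ ν {i}) : (μ.restrict (⋃ i, S i)).map idx ≤ ν := by
  refine Measure.le_intro fun s hs _ => ?_
  rw [← Measure.tsum_indicator_apply_singleton _ s hs,
    ← Measure.tsum_indicator_apply_singleton _ s hs]
  refine ENNReal.tsum_le_tsum fun i => indicator_le_indicator ?_
  rw [Measure.map_apply hidx (measurableSet_singleton i),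
    Measure.restrict_apply (hidx (measurableSet_singleton i))]
  refine (measure_mono ?_).trans (hν i)
  rintro x ⟨hxi, hx⟩
  obtain ⟨j, hj⟩ := mem_iUnion.1 hx
  rwa [← show idx x = i from hxi, hS j x hj]

theorem memLp_of_norm_le_on_pieces [Nonempty ι] [MeasurableSpace ι] [MeasurableSingletonClass ι]
    [NormedAddCommGroup F] {ν : Measure ι} {f : X → E} {a : ι → F} {p : ℝ≥0∞}
    (hS : ∀ i, MeasurableSet (S i)) (hdisj : Pairwise (Disjoint on S))
    (hν : ∀ i, μ (S i) ≤ ν {i}) (hf : AEStronglyMeasurable f μ)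
    (hf0 : Function.support f ⊆ ⋃ i, S i) (hfa : ∀ i, ∀ x ∈ S i, ‖f x‖ ≤ ‖a i‖)
    (ha : MemLp a p ν) : MemLp f p μ := by
  obtain ⟨idx, hidx, hidxS⟩ := exists_measurable_piecewise S hS (fun i _ => i)
    (fun _ => measurable_const) fun i j hij x hx =>
      ((hdisj hij).notMem_of_mem_left hx.1 hx.2).elim
  have hU : MeasurableSet (⋃ i, S i) := .iUnion hS
  have hcomp : MemLp (a ∘ idx) p (μ.restrict (⋃ i, S i)) :=
    (ha.mono_measure (map_restrict_iUnion_le_of_eqOn hidx hidxS hν)).comp_of_map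
      hidx.aemeasurable
  rw [← indicator_eq_self.2 hf0, memLp_indicator_iff_restrict hU]
  refine hcomp.of_le hf.restrict ((ae_restrict_mem hU).mono fun x hx => ?_)
  obtain ⟨i, hi⟩ := mem_iUnion.1 hx
  exact (hfa i x hi).trans_eq (congrArg (fun j => ‖a j‖) (hidxS i hi)).symm

theorem lintegral_rpow_le_mul_lintegral_rpow {f : X → E} (hf : AEStronglyMeasurable f μ) {q : ℝ}
    (hq : 1 ≤ q) :
    (∫⁻ x, ‖f x‖ₑ ∂μ) ^ q ≤ (∫⁻ x, ‖f x‖ₑ ^ q ∂μ) * μ univ ^ (q - 1) := by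
  have hq0 : 0 < q := by linarith
  have h := eLpNorm_le_eLpNorm_mul_rpow_measure_univ (p := 1) (q := ENNReal.ofReal q)
    (by simpa using hq) hf
  rw [eLpNorm_one_eq_lintegral_enorm, eLpNorm_eq_lintegral_rpow_enorm_toReal
    (by simpa using hq0) ENNReal.ofReal_ne_top, ENNReal.toReal_ofReal hq0.le] at h
  calc (∫⁻ x, ‖f x‖ₑ ∂μ) ^ q
      ≤ ((∫⁻ x, ‖f x‖ₑ ^ q ∂μ) ^ (1 / q) * μ univ ^ (1 / (1 : ℝ≥0∞).toReal - 1 / q)) ^ q :=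
        ENNReal.rpow_le_rpow h hq0.le
    _ = (∫⁻ x, ‖f x‖ₑ ^ q ∂μ) * μ univ ^ (q - 1) := by
        rw [ENNReal.mul_rpow_of_nonneg _ _ hq0.le, ← ENNReal.rpow_mul, ← ENNReal.rpow_mul,
          one_div_mul_cancel hq0.ne', ENNReal.rpow_one, ENNReal.toReal_one, sub_mul,
          one_div_mul_cancel hq0.ne', div_one, one_mul]

theorem ofReal_mul_div_rpow_le_lintegral {f : X → E} (hf : AEStronglyMeasurable f μ) {q b V : ℝ}
    (hq : 1 ≤ q) (hb : 0 ≤ b) (hV : 0 < V) (hμ : μ univ ≤ ENNReal.ofReal V)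
    (hbf : ENNReal.ofReal b ≤ ∫⁻ x, ‖f x‖ₑ ∂μ) :
    ENNReal.ofReal (V * (b / V) ^ q) ≤ ∫⁻ x, ‖f x‖ₑ ^ q ∂μ := by
  have hVq : 0 < V ^ (q - 1) := Real.rpow_pos_of_pos hV _
  have hrw : V * (b / V) ^ q = b ^ q / V ^ (q - 1) := by
    rw [Real.div_rpow hb hV.le, Real.rpow_sub_one hV.ne']
    field_simp
  rw [hrw, ENNReal.ofReal_div_of_pos hVq]
  refine ENNReal.div_le_of_le_mul ?_
  rw [← ENNReal.ofReal_rpow_of_nonneg hb (by linarith), ← ENNReal.ofReal_rpow_of_pos hV]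
  calc ENNReal.ofReal b ^ q ≤ (∫⁻ x, ‖f x‖ₑ ∂μ) ^ q := by gcongr
    _ ≤ (∫⁻ x, ‖f x‖ₑ ^ q ∂μ) * μ univ ^ (q - 1) := lintegral_rpow_le_mul_lintegral_rpow hf hq
    _ ≤ (∫⁻ x, ‖f x‖ₑ ^ q ∂μ) * ENNReal.ofReal V ^ (q - 1) := by gcongr

theorem summable_of_le_setLIntegral {f : X → E} {q : ℝ} {b V : ι → ℝ} (hq : 1 ≤ q)
    (hS : ∀ i, MeasurableSet (S i)) (hdisj : Pairwise (Disjoint on S)) (hb : ∀ i, 0 ≤ b i)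
    (hV : ∀ i, 0 < V i) (hμ : ∀ i, μ (S i) ≤ ENNReal.ofReal (V i))
    (hbf : ∀ i, ENNReal.ofReal (b i) ≤ ∫⁻ x in S i, ‖f x‖ₑ ∂μ)
    (hf : MemLp f (ENNReal.ofReal q) μ) : Summable fun i => V i * (b i / V i) ^ q := by
  have hfq : ∫⁻ x, ‖f x‖ₑ ^ q ∂μ < ⊤ := by
    have := lintegral_rpow_enorm_lt_top_of_eLpNorm_lt_top
      (ENNReal.ofReal_pos.2 (by linarith)).ne' ENNReal.ofReal_ne_top hf.2
    rwa [ENNReal.toReal_ofReal (by linarith)] at this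
  have hsum : ∑' i, ENNReal.ofReal (V i * (b i / V i) ^ q) ≠ ⊤ := by
    refine ne_top_of_le_ne_top hfq.ne ?_
    calc ∑' i, ENNReal.ofReal (V i * (b i / V i) ^ q)
        ≤ ∑' i, ∫⁻ x in S i, ‖f x‖ₑ ^ q ∂μ := ENNReal.tsum_le_tsum fun i =>
          ofReal_mul_div_rpow_le_lintegral hf.1.restrict hq (hb i) (hV i)
            ((Measure.restrict_apply_univ (S i)).trans_le (hμ i)) (hbf i)
      _ = ∫⁻ x in ⋃ i, S i, ‖f x‖ₑ ^ q ∂μ := (lintegral_iUnion hS hdisj _).symm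
      _ ≤ ∫⁻ x, ‖f x‖ₑ ^ q ∂μ := setLIntegral_le_lintegral _ _
  refine (ENNReal.summable_toReal hsum).congr fun i => ENNReal.toReal_ofReal ?_
  exact mul_nonneg (hV i).le (Real.rpow_nonneg (div_nonneg (hb i) (hV i).le) q)

end Pieces

theorem HasW1LocExtension.mono {p q : ℝ≥0∞} (hpq : p ≤ q) {Ω : Set (ℝ × ℝ)} {u : ℝ × ℝ → ℝ}
    (h : HasW1LocExtension q Ω u) : HasW1LocExtension p Ω u := by
  obtain ⟨w, hw, hwu⟩ := h
  refine ⟨w, fun U hU hb hc => ?_, hwu⟩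
  obtain ⟨hwq, v, hwv, hvq⟩ := hw U hU hb hc
  have : IsFiniteMeasure (volume.restrict U) := ⟨by
    rw [Measure.restrict_apply_univ]
    exact hb.measure_lt_top⟩
  exact ⟨hwq.mono_exponent hpq, v, hwv, hvq.mono_exponent hpq⟩

section Layers

theorem hasDerivAt_indicator_const {s : Set ℝ} {x : ℝ} (hx : x ∉ frontier s) (c : ℝ) :
    HasDerivAt (s.indicator fun _ => c) 0 x := by
  rw [← mem_compl_iff, compl_frontier_eq_union_interior] at hx
  obtain hx | hx := hx <;> rw [mem_interior_iff_mem_nhds] at hx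
  · exact (hasDerivAt_const x c).congr_of_eventuallyEq
      (by filter_upwards [hx] with y hy using indicator_of_mem hy _)
  · exact (hasDerivAt_const x 0).congr_of_eventuallyEq
      (by filter_upwards [hx] with y hy using indicator_of_notMem hy _)

/-- The heights of the `k`-th layer: the dilation of the model set `J` by the factor `h k`. -/
def heightBand (h : ℕ → ℝ) (J : Set ℝ) (k : ℕ) : Set ℝ := {y | y / h k ∈ J}

/-- A layer with base `B k`: on `B k` it is the function `a k * φ (· / h k)` of the height alone,
and elsewhere it vanishes. -/
noncomputable def layerTerm (B : ℕ → Set ℝ) (h a : ℕ → ℝ) (φ : ℝ → ℝ) (k : ℕ) (z : ℝ × ℝ) : ℝ :=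
  (B k).indicator (fun _ => a k * φ (z.2 / h k)) z.1

/-- The superposition of the layers `layerTerm B h a φ k`. It is used only when these have pairwise
disjoint supports, so that at most one term of the series is nonzero. -/
noncomputable def layerSum (B : ℕ → Set ℝ) (h a : ℕ → ℝ) (φ : ℝ → ℝ) (z : ℝ × ℝ) : ℝ :=
  ∑' k, layerTerm B h a φ k z

/-- The condition on `Ω` under which layer sums are differentiable along the axes at the points of
`Ω`: the jumps of the layers lie outside `Ω`, and the layers accumulate vertically only outside
`Ω`. -/
structure LayerAdapted (B : ℕ → Set ℝ) (h : ℕ → ℝ) (J : Set ℝ) (Ω : Set (ℝ × ℝ)) : Prop where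
  notMem_frontier : ∀ k, ∀ z ∈ Ω, z.2 ∈ heightBand h J k → z.1 ∉ frontier (B k)
  locally_finite : ∀ z ∈ Ω, ∃ N, ∀ᶠ y in 𝓝 z.2, ∀ k ≥ N, (z.1, y) ∉ B k ×ˢ heightBand h J k

variable {B : ℕ → Set ℝ} {h : ℕ → ℝ} {J : Set ℝ} {a : ℕ → ℝ} {φ : ℝ → ℝ} {Ω : Set (ℝ × ℝ)}
  {z : ℝ × ℝ}

theorem measurableSet_heightBand (hJ : MeasurableSet J) (k : ℕ) :
    MeasurableSet (heightBand h J k) :=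
  hJ.preimage (measurable_id.div_const _)

theorem layerTerm_eq_zero (hφ : Function.support φ ⊆ J) {k : ℕ}
    (hz : z ∉ B k ×ˢ heightBand h J k) : layerTerm B h a φ k z = 0 := by
  rw [layerTerm, indicator_apply_eq_zero]
  intro hB
  rw [Function.notMem_support.1 fun hs => hz ⟨hB, hφ hs⟩, mul_zero]

theorem hasSum_layerTerm_of_mem (hdisj : Pairwise (Disjoint on heightBand h J))
    (hφ : Function.support φ ⊆ J) {k : ℕ} (hz : z.2 ∈ heightBand h J k) :
    HasSum (fun j => layerTerm B h a φ j z) (layerTerm B h a φ k z) :=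
  hasSum_single k fun _ hj => layerTerm_eq_zero hφ fun hz' => (hdisj hj).notMem_of_mem_left hz'.2 hz

theorem layerSum_eq_layerTerm (hdisj : Pairwise (Disjoint on heightBand h J))
    (hφ : Function.support φ ⊆ J) {k : ℕ} (hz : z.2 ∈ heightBand h J k) :
    layerSum B h a φ z = layerTerm B h a φ k z :=
  (hasSum_layerTerm_of_mem hdisj hφ hz).tsum_eq

theorem layerSum_eq_zero (hφ : Function.support φ ⊆ J)
    (hz : ∀ k, z ∉ B k ×ˢ heightBand h J k) : layerSum B h a φ z = 0 := by
  simp only [layerSum, layerTerm_eq_zero hφ (hz _), tsum_zero]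

theorem summable_layerTerm (hdisj : Pairwise (Disjoint on heightBand h J))
    (hφ : Function.support φ ⊆ J) (z : ℝ × ℝ) : Summable fun k => layerTerm B h a φ k z := by
  by_cases hz : ∃ k, z.2 ∈ heightBand h J k
  · exact (hasSum_layerTerm_of_mem hdisj hφ hz.choose_spec).summable
  · exact summable_zero.congr fun k => (layerTerm_eq_zero hφ fun hzk => hz ⟨k, hzk.2⟩).symm

theorem measurable_layerSum (hdisj : Pairwise (Disjoint on heightBand h J))
    (hB : ∀ k, MeasurableSet (B k)) (hφ : Function.support φ ⊆ J) (hφm : Measurable φ) :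
    Measurable (layerSum B h a φ) := by
  have hterm (k : ℕ) : Measurable (layerTerm B h a φ k) := by
    have : layerTerm B h a φ k = (Prod.fst ⁻¹' B k).indicator fun z => a k * φ (z.2 / h k) := rfl
    rw [this]
    exact ((hφm.comp (measurable_snd.div_const _)).const_mul _).indicator
      ((hB k).preimage measurable_fst)
  exact measurable_of_tendsto_metrizable
    (fun n => Finset.measurable_sum (Finset.range n) fun k _ => hterm k)
    (tendsto_pi_nhds.2 fun z => (summable_layerTerm hdisj hφ z).hasSum.tendsto_sum_nat)

theorem memLp_layerSum {ν : Measure ℕ} {M : ℝ} {p : ℝ≥0∞}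
    (hdisj : Pairwise (Disjoint on heightBand h J)) (hB : ∀ k, MeasurableSet (B k))
    (hJ : MeasurableSet J) (hν : ∀ k, volume (B k ×ˢ heightBand h J k) ≤ ν {k})
    (hφ : Function.support φ ⊆ J) (hφm : Measurable φ) (hM : ∀ y, ‖φ y‖ ≤ M)
    (ha : MemLp a p ν) : MemLp (layerSum B h a φ) p := by
  refine memLp_of_norm_le_on_pieces (S := fun k => B k ×ˢ heightBand h J k)
    (fun k => (hB k).prod (measurableSet_heightBand hJ k))
    (fun j k hjk => (hdisj hjk).set_prod_right _ _) hν
    (measurable_layerSum hdisj hB hφ hφm).aestronglyMeasurable ?_ ?_ (ha.const_mul M)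
  · intro z hz
    by_contra hzU
    exact hz (layerSum_eq_zero hφ fun k hzk => hzU (mem_iUnion_of_mem k hzk))
  · intro k z hz
    rw [layerSum_eq_layerTerm hdisj hφ hz.2, layerTerm, indicator_of_mem hz.1, norm_mul, norm_mul,
      mul_comm ‖M‖]
    gcongr
    exact (hM _).trans (Real.le_norm_self M)

theorem hasDerivAt_layerSum_fst (hΩ : LayerAdapted B h J Ω)
    (hdisj : Pairwise (Disjoint on heightBand h J)) (hφ : Function.support φ ⊆ J) (hz : z ∈ Ω) :
    HasDerivAt (fun x => layerSum B h a φ (x, z.2)) 0 z.1 := by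
  by_cases hband : ∃ k, z.2 ∈ heightBand h J k
  · obtain ⟨k, hk⟩ := hband
    refine (hasDerivAt_indicator_const (hΩ.notMem_frontier k z hz hk)
      (a k * φ (z.2 / h k))).congr_of_eventuallyEq (.of_forall fun x => ?_)
    exact layerSum_eq_layerTerm (z := (x, z.2)) hdisj hφ hk
  · exact (hasDerivAt_const z.1 (0 : ℝ)).congr_of_eventuallyEq
      (.of_forall fun x => layerSum_eq_zero hφ fun k hk => hband ⟨k, hk.2⟩)

theorem hasDerivAt_layerTerm_snd (hφ : Differentiable ℝ φ) (k : ℕ) :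
    HasDerivAt (fun y => layerTerm B h a φ k (z.1, y))
      (layerTerm B h (fun k => a k / h k) (deriv φ) k z) z.2 := by
  by_cases hz : z.1 ∈ B k
  · simp only [layerTerm, indicator_of_mem hz]
    exact (((hφ _).hasDerivAt.comp z.2 ((hasDerivAt_id z.2).div_const _)).const_mul
      (a k)).congr_deriv (by simp only [id]; ring)
  · simpa only [layerTerm, indicator_of_notMem hz] using hasDerivAt_const z.2 0

theorem hasDerivAt_layerSum_snd (hΩ : LayerAdapted B h J Ω) (hφJ : tsupport φ ⊆ J)
    (hφ : Differentiable ℝ φ) (hz : z ∈ Ω) :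
    HasDerivAt (fun y => layerSum B h a φ (z.1, y))
      (layerSum B h (fun k => a k / h k) (deriv φ) z) z.2 := by
  obtain ⟨N, hN⟩ := hΩ.locally_finite z hz
  have sum_eq {ψ b} (hψ : Function.support ψ ⊆ J) {y}
      (hy : ∀ k ≥ N, (z.1, y) ∉ B k ×ˢ heightBand h J k) :
      layerSum B h b ψ (z.1, y) = ∑ k ∈ Finset.range N, layerTerm B h b ψ k (z.1, y) :=
    tsum_eq_sum fun k hk => layerTerm_eq_zero hψ (hy k (by simpa using hk))
  rw [sum_eq (y := z.2) (support_deriv_subset.trans hφJ) hN.self_of_nhds]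
  refine (HasDerivAt.fun_sum fun k _ => hasDerivAt_layerTerm_snd hφ k).congr_of_eventuallyEq ?_
  filter_upwards [hN] with y hy using sum_eq ((subset_tsupport φ).trans hφJ) hy

theorem memW1_layerSum {ν : Measure ℕ} {p : ℝ≥0∞} (hΩ : LayerAdapted B h J Ω)
    (hdisj : Pairwise (Disjoint on heightBand h J)) (hB : ∀ k, MeasurableSet (B k))
    (hJ : MeasurableSet J) (hν : ∀ k, volume (B k ×ˢ heightBand h J k) ≤ ν {k})
    (hh : ∀ k, h k ∈ Ioc 0 1) (hφJ : tsupport φ ⊆ J) (hφc : HasCompactSupport φ)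
    (hφ : ContDiff ℝ 1 φ) (hp : 1 ≤ p) (ha : MemLp (fun k => a k / h k) p ν) :
    MemW1 p Ω (layerSum B h a φ) := by
  obtain ⟨M, hM⟩ := hφc.exists_bound_of_continuous hφ.continuous
  obtain ⟨M', hM'⟩ := hφc.deriv.exists_bound_of_continuous (hφ.continuous_deriv le_rfl)
  have hs : Function.support φ ⊆ J := (subset_tsupport φ).trans hφJ
  have hs' : Function.support (deriv φ) ⊆ J := support_deriv_subset.trans hφJ
  have ha' : MemLp a p ν := ha.of_le .of_discrete (.of_forall fun k => by
    rw [norm_div, Real.norm_of_nonneg (hh k).1.le]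
    exact le_div_self (norm_nonneg _) (hh k).1 (hh k).2)
  have hu : MemLp (layerSum B h a φ) p :=
    memLp_layerSum hdisj hB hJ hν hs hφ.continuous.measurable hM ha'
  have hv₂ : MemLp (layerSum B h (fun k => a k / h k) (deriv φ)) p :=
    memLp_layerSum hdisj hB hJ hν hs' (hφ.continuous_deriv le_rfl).measurable hM' ha
  have hv : MemLp (fun z => ((0 : ℝ), layerSum B h (fun k => a k / h k) (deriv φ) z)) p :=
    hv₂.of_le (aestronglyMeasurable_const.prodMk hv₂.1) (.of_forall fun z => by simp)
  exact ⟨hu.restrict Ω, _, hasWeakGradientOn_of_hasLineDerivAt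
    ((hu.locallyIntegrable hp).locallyIntegrableOn Ω)
    ((hv.locallyIntegrable hp).locallyIntegrableOn Ω)
    (fun _ hz => hasLineDerivAt_fst (hasDerivAt_layerSum_fst hΩ hdisj hs hz))
    (fun _ hz => hasLineDerivAt_snd (hasDerivAt_layerSum_snd hΩ hφJ
      (hφ.differentiable one_ne_zero) hz)), hv.restrict Ω⟩

end Layers

section CantorSet

/-- The numbers `n` such that `[n / 3 ^ k, (n + 1) / 3 ^ k]` is one of the `2 ^ k` intervals of
generation `k` in the construction of the Cantor set. -/
def cantorIndices : ℕ → Finset ℕ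
  | 0 => {0}
  | k + 1 => cantorIndices k ∪ (cantorIndices k).image (2 * 3 ^ k + ·)

theorem mem_cantorIndices_succ {k n : ℕ} :
    n ∈ cantorIndices (k + 1) ↔
      n ∈ cantorIndices k ∨ ∃ m ∈ cantorIndices k, 2 * 3 ^ k + m = n := by
  rw [cantorIndices, Finset.mem_union, Finset.mem_image]

theorem lt_of_mem_cantorIndices {k n : ℕ} (hn : n ∈ cantorIndices k) : n < 3 ^ k := by
  induction k generalizing n with
  | zero => simp_all [cantorIndices]
  | succ k ih =>
    rw [pow_succ]
    obtain hn | ⟨m, hm, rfl⟩ := mem_cantorIndices_succ.1 hn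
    · linarith [ih hn]
    · linarith [ih hm]

theorem card_cantorIndices (k : ℕ) : (cantorIndices k).card = 2 ^ k := by
  induction k with
  | zero => rfl
  | succ k ih =>
    have hdisj : Disjoint (cantorIndices k) ((cantorIndices k).image (2 * 3 ^ k + ·)) := by
      rw [Finset.disjoint_left]
      rintro n hn hn'
      obtain ⟨m, -, rfl⟩ := Finset.mem_image.1 hn'
      have := lt_of_mem_cantorIndices hn
      have : 0 < 3 ^ k := by positivity
      omega
    rw [cantorIndices, Finset.card_union_of_disjoint hdisj,
      Finset.card_image_of_injective _ (add_right_injective _), ih, pow_succ, mul_two]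

theorem div_three_mem_cantorSet_iff {x : ℝ} (hx : x ≤ 1) : x / 3 ∈ cantorSet ↔ x ∈ cantorSet := by
  constructor
  · rw [cantorSet_eq_union_halves]
    rintro (⟨y, hy, hyx⟩ | ⟨y, hy, hyx⟩) <;> simp only at hyx
    · rwa [← cantorSet_eq_union_halves, show x = y by linarith]
    · linarith [(cantorSet_subset_unitInterval hy).1]
  · intro h
    rw [cantorSet_eq_union_halves]
    exact .inl ⟨x, h, rfl⟩

theorem two_add_div_three_mem_cantorSet_iff {x : ℝ} (hx : 0 ≤ x) :
    (2 + x) / 3 ∈ cantorSet ↔ x ∈ cantorSet := by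
  constructor
  · rw [cantorSet_eq_union_halves]
    rintro (⟨y, hy, hyx⟩ | ⟨y, hy, hyx⟩) <;> simp only at hyx
    · linarith [(cantorSet_subset_unitInterval hy).2]
    · rwa [← cantorSet_eq_union_halves, show x = y by linarith]
  · intro h
    rw [cantorSet_eq_union_halves]
    exact .inr ⟨x, h, rfl⟩

theorem add_div_three_pow_mem_Icc {k n : ℕ} (hn : n ∈ cantorIndices k) {z : ℝ}
    (hz : z ∈ Icc (0 : ℝ) 1) : (n + z) / 3 ^ k ∈ Icc (0 : ℝ) 1 := by
  have hlt : (n : ℝ) + 1 ≤ 3 ^ k := by exact_mod_cast lt_of_mem_cantorIndices hn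
  exact ⟨div_nonneg (by linarith [hz.1, n.cast_nonneg (α := ℝ)]) (by positivity),
    div_le_one_of_le₀ (by linarith [hz.2]) (by positivity)⟩

theorem add_div_three_pow_mem_cantorSet_iff {k n : ℕ} (hn : n ∈ cantorIndices k) {z : ℝ}
    (hz : z ∈ Icc (0 : ℝ) 1) : (n + z) / 3 ^ k ∈ cantorSet ↔ z ∈ cantorSet := by
  induction k generalizing n with
  | zero =>
    obtain rfl : n = 0 := by simpa [cantorIndices] using hn
    simp
  | succ k ih =>
    obtain hn | ⟨m, hm, rfl⟩ := mem_cantorIndices_succ.1 hn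
    · rw [pow_succ, ← div_div, div_three_mem_cantorSet_iff (add_div_three_pow_mem_Icc hn hz).2,
        ih hn]
    · have : ((2 * 3 ^ k + m : ℕ) + z) / 3 ^ (k + 1) = (2 + (m + z) / 3 ^ k) / 3 := by
        push_cast
        field_simp
        ring
      rw [this, two_add_div_three_mem_cantorSet_iff (add_div_three_pow_mem_Icc hm hz).1, ih hm]

theorem one_mem_cantorSet : (1 : ℝ) ∈ cantorSet := by
  refine mem_iInter.2 fun n => ?_
  induction n with
  | zero => simp
  | succ n ih => exact .inr ⟨1, ih, by norm_num⟩

theorem one_third_mem_cantorSet : (1 / 3 : ℝ) ∈ cantorSet :=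
  (div_three_mem_cantorSet_iff le_rfl).2 one_mem_cantorSet

theorem two_thirds_mem_cantorSet : (2 / 3 : ℝ) ∈ cantorSet := by
  simpa using (two_add_div_three_mem_cantorSet_iff le_rfl).2 zero_mem_cantorSet

theorem Ioo_one_third_two_thirds_subset_compl : Ioo (1 / 3 : ℝ) (2 / 3) ⊆ cantorSetᶜ := by
  rintro x ⟨hx₁, hx₂⟩ hx
  rw [cantorSet_eq_union_halves] at hx
  obtain ⟨y, hy, rfl⟩ | ⟨y, hy, rfl⟩ := hx
  · linarith [(cantorSet_subset_unitInterval hy).2]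
  · linarith [(cantorSet_subset_unitInterval hy).1]

theorem Ioo_one_ninth_two_ninths_subset_compl : Ioo (1 / 9 : ℝ) (2 / 9) ⊆ cantorSetᶜ := by
  rintro x ⟨hx₁, hx₂⟩ hx
  rw [← mul_div_cancel_left₀ x three_ne_zero, div_three_mem_cantorSet_iff (by linarith)] at hx
  exact Ioo_one_third_two_thirds_subset_compl ⟨by linarith, by linarith⟩ hx

theorem Ioo_seven_ninths_eight_ninths_subset_compl :
    Ioo (7 / 9 : ℝ) (8 / 9) ⊆ cantorSetᶜ := by
  rintro x ⟨hx₁, hx₂⟩ hx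
  rw [show x = (2 + (3 * x - 2)) / 3 by ring,
    two_add_div_three_mem_cantorSet_iff (by linarith)] at hx
  exact Ioo_one_third_two_thirds_subset_compl ⟨by linarith, by linarith⟩ hx

end CantorSet

section CantorPsi

variable {α : ℝ} {k n : ℕ}

/-- The factor by which `cantorPsi α` scales on the intervals of generation `k`. -/
noncomputable def cantorHeight (α : ℝ) (k : ℕ) : ℝ := ((3 : ℝ) ^ k) ^ (-α)

theorem cantorHeight_pos (α : ℝ) (k : ℕ) : 0 < cantorHeight α k := by
  rw [cantorHeight]
  positivity

theorem cantorHeight_le_one (hα : 0 ≤ α) (k : ℕ) : cantorHeight α k ≤ 1 :=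
  Real.rpow_le_one_of_one_le_of_nonpos (one_le_pow₀ (by norm_num)) (neg_nonpos.2 hα)

theorem tendsto_cantorHeight (hα : 0 < α) :
    Filter.Tendsto (cantorHeight α) Filter.atTop (𝓝 0) :=
  (tendsto_rpow_neg_atTop hα).comp (tendsto_pow_atTop_atTop_of_one_lt (by norm_num))

theorem rpow_mul_cantorHeight {δ : ℝ} (hδ : 0 ≤ δ) (α : ℝ) (k : ℕ) :
    δ ^ α * cantorHeight α k = (δ / 3 ^ k) ^ α := by
  rw [cantorHeight, Real.div_rpow hδ (by positivity), Real.rpow_neg (by positivity), div_eq_mul_inv]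

theorem cantorHeight_le_of_lt (hα : 0 ≤ α) {j : ℕ} (h : j < k) :
    cantorHeight α k ≤ (1 / 3) ^ α * cantorHeight α j := by
  have hpow : (3 : ℝ) ^ j * 3 ≤ 3 ^ k := by
    rw [← pow_succ]
    exact pow_le_pow_right₀ (by norm_num) h
  have hk : cantorHeight α k = (1 / 3 ^ k) ^ α := by
    simpa using rpow_mul_cantorHeight zero_le_one α k
  rw [hk, rpow_mul_cantorHeight (by norm_num), div_div]
  gcongr
  linarith

theorem cantorPsi_nonneg (α x : ℝ) : 0 ≤ cantorPsi α x := by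
  rw [cantorPsi]
  split_ifs
  · exact Real.rpow_nonneg Metric.infDist_nonneg _
  · exact le_rfl

theorem measurable_cantorPsi (α : ℝ) : Measurable (cantorPsi α) :=
  .ite measurableSet_Ioo ((Metric.continuous_infDist_pt _).measurable.pow_const α) measurable_const

theorem cantorPsi_add_div_three_pow_le (hα : 0 ≤ α) (hn : n ∈ cantorIndices k) {c z δ : ℝ}
    (hc : c ∈ cantorSet) (hz : dist z c ≤ δ) :
    cantorPsi α ((n + z) / 3 ^ k) ≤ δ ^ α * cantorHeight α k := by
  have hδ : 0 ≤ δ := dist_nonneg.trans hz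
  rw [rpow_mul_cantorHeight hδ, cantorPsi]
  split_ifs
  · refine Real.rpow_le_rpow Metric.infDist_nonneg ?_ hα
    refine (Metric.infDist_le_dist_of_mem ((add_div_three_pow_mem_cantorSet_iff hn
      (cantorSet_subset_unitInterval hc)).2 hc)).trans ?_
    rw [Real.dist_eq, ← sub_div, add_sub_add_left_eq_sub, abs_div,
      abs_of_pos (by positivity : (0 : ℝ) < 3 ^ k)]
    gcongr
    exact hz
  · positivity

theorem cantorPsi_add_div_three_pow_eq_zero (hα : 0 < α) (hn : n ∈ cantorIndices k) {c : ℝ}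
    (hc : c ∈ cantorSet) : cantorPsi α ((n + c) / 3 ^ k) = 0 := by
  refine le_antisymm ?_ (cantorPsi_nonneg α _)
  simpa [Real.zero_rpow hα.ne'] using cantorPsi_add_div_three_pow_le hα.le hn hc (dist_self c).le

theorem le_cantorPsi_add_div_three_pow (hα : 0 ≤ α) (hn : n ∈ cantorIndices k) {z δ : ℝ}
    (hδ : 0 < δ) (hz : Metric.ball z δ ⊆ Icc 0 1 \ cantorSet) :
    δ ^ α * cantorHeight α k ≤ cantorPsi α ((n + z) / 3 ^ k) := by
  have hz01 : z ∈ Ioo (0 : ℝ) 1 := by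
    rw [← interior_Icc, mem_interior_iff_mem_nhds]
    exact Filter.mem_of_superset (Metric.ball_mem_nhds z hδ) (hz.trans sdiff_subset)
  have hlt : (n : ℝ) + 1 ≤ 3 ^ k := by exact_mod_cast lt_of_mem_cantorIndices hn
  have hx : (n + z) / 3 ^ k ∈ Ioo (0 : ℝ) 1 :=
    ⟨div_pos (by linarith [hz01.1, n.cast_nonneg (α := ℝ)]) (by positivity),
      (div_lt_one (by positivity)).2 (by linarith [hz01.2])⟩
  rw [rpow_mul_cantorHeight hδ.le, cantorPsi, if_pos hx]
  refine Real.rpow_le_rpow (by positivity) ?_ hα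
  rw [Metric.le_infDist ⟨0, zero_mem_cantorSet⟩]
  intro y hy
  by_contra! hdist
  obtain ⟨w, rfl⟩ : ∃ w, y = (n + w) / 3 ^ k := ⟨y * 3 ^ k - n, by field_simp; ring⟩
  rw [Real.dist_eq, ← sub_div, add_sub_add_left_eq_sub, abs_div,
    abs_of_pos (by positivity : (0 : ℝ) < 3 ^ k),
    div_lt_div_iff_of_pos_right (by positivity), abs_sub_comm] at hdist
  obtain ⟨hw01, hw⟩ := hz (Metric.mem_ball.2 hdist)
  exact hw ((add_div_three_pow_mem_cantorSet_iff hn hw01).1 hy)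

end CantorPsi

section CantorAdapted

variable {α l : ℝ} {k n : ℕ}

/-- The model set of heights: the points at height `cantorHeight α k * y`, for `y` in this set, lie
below the graph of `cantorPsi α` where the distance to the Cantor set is at least `3⁻ᵏ / 27`, and
above it where that distance is at most `3⁻ᵏ / 54`. -/
def cantorBand (α : ℝ) : Set ℝ := Ioo ((1 / 54) ^ α) ((1 / 27) ^ α)

theorem mem_heightBand_cantorBand_iff {y : ℝ} :
    y ∈ heightBand (cantorHeight α) (cantorBand α) k ↔
      (1 / 54) ^ α * cantorHeight α k < y ∧ y < (1 / 27) ^ α * cantorHeight α k :=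
  and_congr (lt_div_iff₀ (cantorHeight_pos α k)) (div_lt_iff₀ (cantorHeight_pos α k))

theorem pos_of_mem_heightBand_cantorBand {y : ℝ}
    (hy : y ∈ heightBand (cantorHeight α) (cantorBand α) k) : 0 < y :=
  (mul_pos (by positivity) (cantorHeight_pos α k)).trans (mem_heightBand_cantorBand_iff.1 hy).1

theorem heightBand_cantorBand_subset (hα : 0 ≤ α) (k : ℕ) :
    heightBand (cantorHeight α) (cantorBand α) k ⊆ Ioo 0 (cantorHeight α k) := fun _ hy =>
  ⟨pos_of_mem_heightBand_cantorBand hy, (mem_heightBand_cantorBand_iff.1 hy).2.trans_le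
    (mul_le_of_le_one_left (cantorHeight_pos α k).le
      (Real.rpow_le_one (by norm_num) (by norm_num) hα))⟩

theorem volume_heightBand_cantorBand_le (hα : 0 ≤ α) (k : ℕ) :
    volume (heightBand (cantorHeight α) (cantorBand α) k) ≤ ENNReal.ofReal (cantorHeight α k) :=
  (measure_mono (heightBand_cantorBand_subset hα k)).trans_eq (by rw [Real.volume_Ioo, sub_zero])

theorem pairwise_disjoint_heightBand_cantorBand (hα : 0 ≤ α) :
    Pairwise (Disjoint on heightBand (cantorHeight α) (cantorBand α)) := by
  refine (pairwise_disjoint_on _).2 fun j k hjk => disjoint_left.2 fun y hyj hyk => ?_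
  rw [mem_heightBand_cantorBand_iff] at hyj hyk
  refine (hyj.1.trans hyk.2).not_ge ?_
  calc (1 / 27) ^ α * cantorHeight α k
      ≤ (1 / 27) ^ α * ((1 / 3) ^ α * cantorHeight α j) := by
        gcongr
        exact cantorHeight_le_of_lt hα hjk
    _ = (1 / 27 * (1 / 3)) ^ α * cantorHeight α j := by
        rw [← mul_assoc, Real.mul_rpow (by norm_num) (by norm_num)]
    _ ≤ (1 / 54) ^ α * cantorHeight α j := by
        have := (cantorHeight_pos α j).le
        gcongr
        norm_num

/-- The base of the `k`-th layer: in each interval `[n, n + 1] / 3 ^ k` of generation `k`, the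
interval of a third of its length that begins at the relative position `l`. -/
def cantorBlocks (l : ℝ) (k : ℕ) : Set ℝ :=
  ⋃ n ∈ cantorIndices k, Ioo ((n + l) / 3 ^ k) ((n + (l + 1 / 3)) / 3 ^ k)

theorem isOpen_cantorBlocks (l : ℝ) (k : ℕ) : IsOpen (cantorBlocks l k) :=
  isOpen_biUnion fun _ _ => isOpen_Ioo

theorem volume_cantorBlocks_le (l : ℝ) (k : ℕ) :
    volume (cantorBlocks l k) ≤ ENNReal.ofReal (2 ^ k / 3 ^ k) := by
  refine (measure_biUnion_finset_le _ _).trans ?_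
  have hlen (n : ℕ) : (n + (l + 1 / 3)) / 3 ^ k - (n + l) / 3 ^ k = 1 / 3 / 3 ^ k := by ring
  simp only [Real.volume_Ioo, hlen, Finset.sum_const, card_cantorIndices, ← ENNReal.ofReal_nsmul]
  refine ENNReal.ofReal_le_ofReal ?_
  rw [nsmul_eq_mul, Nat.cast_pow, Nat.cast_ofNat, ← mul_div_assoc]
  gcongr
  exact mul_le_of_le_one_right (by positivity) (by norm_num)

theorem exists_eq_of_mem_frontier_cantorBlocks {x : ℝ} (hx : x ∈ frontier (cantorBlocks l k)) :
    ∃ n ∈ cantorIndices k, x = (n + l) / 3 ^ k ∨ x = (n + (l + 1 / 3)) / 3 ^ k := by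
  rw [(isOpen_cantorBlocks l k).frontier_eq, cantorBlocks, Finset.closure_biUnion] at hx
  obtain ⟨n, hn, hxn⟩ := mem_iUnion₂.1 hx.1
  refine ⟨n, hn, ?_⟩
  have hxIoo : x ∉ Ioo ((n + l) / 3 ^ k) ((n + (l + 1 / 3)) / 3 ^ k) :=
    fun h => hx.2 (mem_biUnion hn h)
  by_contra! hne
  have hxIcc := closure_minimal Ioo_subset_Icc_self isClosed_Icc hxn
  exact hxIoo ⟨hxIcc.1.lt_of_ne' hne.1, hxIcc.2.lt_of_ne hne.2⟩

theorem mem_cantorBlocks_iff (hn : n ∈ cantorIndices k) {x : ℝ} (hx : |x - (l + 1 / 3)| < 1 / 3) :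
    (n + x) / 3 ^ k ∈ cantorBlocks l k ↔ x < l + 1 / 3 := by
  have h3 : (0 : ℝ) < 3 ^ k := by positivity
  rw [abs_lt] at hx
  simp only [cantorBlocks, mem_iUnion₂, mem_Ioo, div_lt_div_iff_of_pos_right h3]
  constructor
  · rintro ⟨m, -, hm⟩
    have hmn : m < n + 1 := by exact_mod_cast (by linarith : (m : ℝ) < n + 1)
    have hnm : n < m + 1 := by exact_mod_cast (by linarith : (n : ℝ) < m + 1)
    obtain rfl : m = n := by omega
    linarith
  · exact fun h => ⟨n, hn, by linarith, by linarith⟩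

/-- The geometric condition on `Ω` under which layers over `cantorBlocks l` are admissible and jump
across its complement: besides `LayerAdapted`, on both sides of the right end point of each block
there is a window that, at the heights of the layer, lies in `Ω`. -/
structure CantorAdapted (α l : ℝ) (Ω : Set (ℝ × ℝ)) : Prop extends
    LayerAdapted (cantorBlocks l) (cantorHeight α) (cantorBand α) Ω where
  measurableSet : MeasurableSet Ω
  window_subset : ∀ k, ∀ n ∈ cantorIndices k, ∀ x, |x - (l + 1 / 3)| ∈ Icc (4 / 27 : ℝ) (5 / 27) →
    ∀ y ∈ heightBand (cantorHeight α) (cantorBand α) k, ((n + x) / 3 ^ k, y) ∈ Ω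

theorem mk_mem_cantorLower_of_ball_subset (hα : 0 ≤ α) (hn : n ∈ cantorIndices k) {x y : ℝ}
    (hx : Metric.ball x (1 / 27) ⊆ Icc 0 1 \ cantorSet)
    (hy : y ∈ heightBand (cantorHeight α) (cantorBand α) k) :
    ((n + x) / 3 ^ k, y) ∈ cantorLower α :=
  (mem_heightBand_cantorBand_iff.1 hy).2.trans_le
    (le_cantorPsi_add_div_three_pow hα hn (by norm_num) hx)

theorem mk_mem_cantorUpper_of_dist_le (hα : 0 ≤ α) (hn : n ∈ cantorIndices k) {c x y : ℝ}
    (hc : c ∈ cantorSet) (hx : dist x c ≤ 1 / 54)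
    (hy : y ∈ heightBand (cantorHeight α) (cantorBand α) k) :
    ((n + x) / 3 ^ k, y) ∈ cantorUpper α :=
  (cantorPsi_add_div_three_pow_le hα hn hc hx).trans_lt (mem_heightBand_cantorBand_iff.1 hy).1

theorem layerAdapted_cantorLower (hα : 0 < α) :
    LayerAdapted (cantorBlocks (1 / 3)) (cantorHeight α) (cantorBand α) (cantorLower α) where
  notMem_frontier k z hz hy hx := by
    have hψ : cantorPsi α z.1 = 0 := by
      obtain ⟨n, hn, hx | hx⟩ := exists_eq_of_mem_frontier_cantorBlocks hx <;> rw [hx]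
      · exact cantorPsi_add_div_three_pow_eq_zero hα hn one_third_mem_cantorSet
      · refine cantorPsi_add_div_three_pow_eq_zero hα hn ?_
        convert two_thirds_mem_cantorSet using 1
        norm_num
    exact (hψ ▸ hz : z.2 < 0).not_gt (pos_of_mem_heightBand_cantorBand hy)
  locally_finite z hz := by
    obtain hneg | hpos := lt_or_ge z.2 0
    · refine ⟨0, ?_⟩
      filter_upwards [Iio_mem_nhds hneg] with y hy k _ hk
      exact hy.not_gt (pos_of_mem_heightBand_cantorBand hk.2)
    · have hlim := (tendsto_cantorHeight hα).const_mul ((1 / 3) ^ α)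
      rw [mul_zero] at hlim
      obtain ⟨N, hN⟩ := Filter.eventually_atTop.1 (hlim.eventually_lt_const (hpos.trans_lt hz))
      refine ⟨N, .of_forall fun y k hk hzk => (hN k hk).not_ge ?_⟩
      obtain ⟨n, hn, hx⟩ := mem_iUnion₂.1 hzk.1
      have h3 : (0 : ℝ) < 3 ^ k := by positivity
      obtain ⟨x, hzx⟩ : ∃ x, z.1 = (n + x) / 3 ^ k := ⟨z.1 * 3 ^ k - n, by field_simp; ring⟩
      rw [hzx, mem_Ioo, div_lt_div_iff_of_pos_right h3, div_lt_div_iff_of_pos_right h3] at hx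
      rw [hzx]
      refine cantorPsi_add_div_three_pow_le hα.le hn one_third_mem_cantorSet ?_
      rw [Real.dist_eq, abs_le]
      constructor <;> linarith [hx.1, hx.2]

theorem cantorAdapted_cantorLower (hα : 0 < α) : CantorAdapted α (1 / 3) (cantorLower α) where
  toLayerAdapted := layerAdapted_cantorLower hα
  measurableSet := measurableSet_lt measurable_snd ((measurable_cantorPsi α).comp measurable_fst)
  window_subset k n hn x hx y hy := by
    refine mk_mem_cantorLower_of_ball_subset hα.le hn ?_ hy
    rw [Real.ball_eq_Ioo]
    obtain h | h := le_total (x - (1 / 3 + 1 / 3)) 0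
    · rw [abs_of_nonpos h] at hx
      exact fun w hw => ⟨⟨by linarith [hw.1, hx.2], by linarith [hw.2, hx.1]⟩,
        Ioo_one_third_two_thirds_subset_compl
          ⟨by linarith [hw.1, hx.2], by linarith [hw.2, hx.1]⟩⟩
    · rw [abs_of_nonneg h] at hx
      exact fun w hw => ⟨⟨by linarith [hw.1, hx.1], by linarith [hw.2, hx.2]⟩,
        Ioo_seven_ninths_eight_ninths_subset_compl
          ⟨by linarith [hw.1, hx.1], by linarith [hw.2, hx.2]⟩⟩

theorem layerAdapted_cantorUpper (hα : 0 < α) :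
    LayerAdapted (cantorBlocks (1 / 6)) (cantorHeight α) (cantorBand α) (cantorUpper α) where
  notMem_frontier k := by
    rintro ⟨x, y⟩ (hz : cantorPsi α x < y) hy hx
    refine hz.not_gt ?_
    obtain ⟨n, hn, rfl | rfl⟩ := exists_eq_of_mem_frontier_cantorBlocks hx
    all_goals
      refine mk_mem_cantorLower_of_ball_subset hα.le hn ?_ hy
      rw [Real.ball_eq_Ioo]
    · exact fun w hw => ⟨⟨by linarith [hw.1], by linarith [hw.2]⟩,
        Ioo_one_ninth_two_ninths_subset_compl ⟨by linarith [hw.1], by linarith [hw.2]⟩⟩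
    · exact fun w hw => ⟨⟨by linarith [hw.1], by linarith [hw.2]⟩,
        Ioo_one_third_two_thirds_subset_compl ⟨by linarith [hw.1], by linarith [hw.2]⟩⟩
  locally_finite z hz := by
    obtain ⟨c, hc0, hcz⟩ := exists_between ((cantorPsi_nonneg α z.1).trans_lt hz)
    obtain ⟨N, hN⟩ := Filter.eventually_atTop.1
      ((tendsto_cantorHeight hα).eventually_lt_const hc0)
    refine ⟨N, ?_⟩
    filter_upwards [Ioi_mem_nhds hcz] with y hy k hk hyk
    exact ((heightBand_cantorBand_subset hα.le k hyk.2).2.trans (hN k hk)).not_gt hy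

theorem cantorAdapted_cantorUpper (hα : 0 < α) : CantorAdapted α (1 / 6) (cantorUpper α) where
  toLayerAdapted := layerAdapted_cantorUpper hα
  measurableSet := measurableSet_lt ((measurable_cantorPsi α).comp measurable_fst) measurable_snd
  window_subset k n hn x hx y hy := by
    obtain h | h := le_total (x - (1 / 6 + 1 / 3)) 0
    · rw [abs_of_nonpos h] at hx
      refine mk_mem_cantorUpper_of_dist_le hα.le hn one_third_mem_cantorSet ?_ hy
      exact abs_le.2 ⟨by linarith [hx.2], by linarith [hx.1]⟩
    · rw [abs_of_nonneg h] at hx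
      refine mk_mem_cantorUpper_of_dist_le hα.le hn two_thirds_mem_cantorSet ?_ hy
      exact abs_le.2 ⟨by linarith [hx.1], by linarith [hx.2]⟩

end CantorAdapted

section Nonextension

variable {α l : ℝ} {k n : ℕ} {φ : ℝ → ℝ} {a : ℕ → ℝ} {Ω : Set (ℝ × ℝ)}

/-- The order of magnitude of the area of the `k`-th layer over `cantorBlocks l`. -/
noncomputable def cantorWeight (α : ℝ) (k : ℕ) : ℝ := 2 ^ k / 3 ^ k * cantorHeight α k

theorem cantorWeight_pos (α : ℝ) (k : ℕ) : 0 < cantorWeight α k :=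
  mul_pos (by positivity) (cantorHeight_pos α k)

/-- The measure on the set of layers that gives the `k`-th layer the mass `cantorWeight α k`: the
`W^{1,p}` norm of a layer sum is controlled by an `L^p` norm with respect to it. -/
noncomputable def cantorLayerMeasure (α : ℝ) : Measure ℕ :=
  .sum fun k => ENNReal.ofReal (cantorWeight α k) • .dirac k

theorem cantorLayerMeasure_singleton (α : ℝ) (k : ℕ) :
    cantorLayerMeasure α {k} = ENNReal.ofReal (cantorWeight α k) := by
  rw [cantorLayerMeasure, Measure.sum_smul_dirac_singleton]

theorem memLp_cantorLayerMeasure_iff {f : ℕ → ℝ} {p : ℝ} (hp : 0 < p) :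
    MemLp f (ENNReal.ofReal p) (cantorLayerMeasure α) ↔
      Summable fun k => cantorWeight α k * |f k| ^ p := by
  have hterm (k : ℕ) : ENNReal.ofReal (cantorWeight α k) * ‖f k‖ₑ ^ p =
      ENNReal.ofReal (cantorWeight α k * |f k| ^ p) := by
    rw [ENNReal.ofReal_mul (cantorWeight_pos α k).le, Real.enorm_eq_ofReal_abs,
      ENNReal.ofReal_rpow_of_nonneg (abs_nonneg _) hp.le]
  have hnonneg (k : ℕ) : 0 ≤ cantorWeight α k * |f k| ^ p :=
    mul_nonneg (cantorWeight_pos α k).le (by positivity)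
  have heLp := eLpNorm_lt_top_iff_lintegral_rpow_enorm_lt_top (f := f) (μ := cantorLayerMeasure α)
    (ENNReal.ofReal_pos.2 hp).ne' ENNReal.ofReal_ne_top
  simp only [ENNReal.toReal_ofReal hp.le, lintegral_countable', cantorLayerMeasure_singleton,
    mul_comm _ (ENNReal.ofReal (cantorWeight α _)), hterm] at heLp
  rw [MemLp, and_iff_right .of_discrete, heLp]
  refine ⟨fun h => ?_, Summable.tsum_ofReal_lt_top⟩
  simpa only [ENNReal.toReal_ofReal (hnonneg _)] using ENNReal.summable_toReal h.ne

/-- The cell around the right end point of the `n`-th block of the `k`-th layer. Its horizontal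
neighbourhood is so small that the cells are pairwise disjoint. -/
def cantorCell (α l : ℝ) (k n : ℕ) : Set (ℝ × ℝ) :=
  Metric.ball ((n + (l + 1 / 3)) / 3 ^ k) (5 / 27 / 3 ^ k) ×ˢ
    heightBand (cantorHeight α) (cantorBand α) k

theorem measurableSet_cantorCell (α l : ℝ) (k n : ℕ) : MeasurableSet (cantorCell α l k n) :=
  Metric.isOpen_ball.measurableSet.prod (measurableSet_heightBand measurableSet_Ioo k)

theorem volume_cantorCell_le (hα : 0 ≤ α) (l : ℝ) (k n : ℕ) :
    volume (cantorCell α l k n) ≤ ENNReal.ofReal (cantorHeight α k / 3 ^ k) := by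
  have hball : volume (Metric.ball ((n + (l + 1 / 3)) / 3 ^ k : ℝ) (5 / 27 / 3 ^ k)) ≤
      ENNReal.ofReal (1 / 3 ^ k) := by
    rw [Real.volume_ball, ← mul_div_assoc]
    gcongr
    norm_num
  rw [cantorCell, Measure.volume_eq_prod, Measure.prod_prod,
    ← one_div_mul_eq_div _ (cantorHeight α k),
    ENNReal.ofReal_mul (by positivity)]
  exact mul_le_mul' hball (volume_heightBand_cantorBand_le hα k)

theorem pairwise_disjoint_cantorCell (hα : 0 ≤ α) (l : ℝ) :
    Pairwise (Disjoint on fun i : Σ k, cantorIndices k => cantorCell α l i.1 i.2) := by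
  rintro ⟨j, m⟩ ⟨k, n⟩ hne
  obtain rfl | hjk := eq_or_ne j k
  · have hmn : (1 : ℝ) ≤ |(m : ℝ) - n| := by
      have : (m : ℤ) - n ≠ 0 := by
        rw [sub_ne_zero, Nat.cast_injective.ne_iff, Subtype.coe_ne_coe]
        rintro rfl
        exact hne rfl
      exact_mod_cast Int.one_le_abs this
    refine disjoint_prod.2 (.inl (Metric.ball_disjoint_ball ?_))
    rw [Real.dist_eq, ← sub_div, add_sub_add_right_eq_sub, abs_div,
      abs_of_pos (by positivity : (0 : ℝ) < 3 ^ j), ← add_div]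
    gcongr
    linarith
  · exact disjoint_prod.2 (.inr (pairwise_disjoint_heightBand_cantorBand hα hjk))

theorem closedBall_prod_heightBand_subset_ball (hα : 0 ≤ α) (hn : n ∈ cantorIndices k) :
    Metric.closedBall ((n + (l + 1 / 3)) / 3 ^ k) (5 / 27 / 3 ^ k) ×ˢ
      heightBand (cantorHeight α) (cantorBand α) k ⊆ Metric.ball 0 (|l| + 2) := by
  rintro z ⟨hz₁, hz₂⟩
  have hy := heightBand_cantorBand_subset hα k hz₂
  have h3 : (1 : ℝ) ≤ 3 ^ k := one_le_pow₀ (by norm_num)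
  have hnk : (n : ℝ) + 1 ≤ 3 ^ k := by exact_mod_cast lt_of_mem_cantorIndices hn
  have hz : |z.1 - (n + (l + 1 / 3)) / 3 ^ k| ≤ 5 / 27 :=
    hz₁.trans (div_le_self (by norm_num) h3)
  have hc : |(n + (l + 1 / 3)) / 3 ^ k| ≤ |l| + 4 / 3 := by
    rw [abs_div, abs_of_pos (by linarith : (0 : ℝ) < 3 ^ k), div_le_iff₀ (by linarith)]
    calc |n + (l + 1 / 3)| ≤ n + |l| + 1 / 3 := by
          rw [abs_le]
          constructor <;> linarith [neg_abs_le l, le_abs_self l, n.cast_nonneg (α := ℝ)]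
      _ ≤ (|l| + 4 / 3) * 3 ^ k := by nlinarith [abs_nonneg l]
  rw [mem_ball_zero_iff, Prod.norm_def, max_lt_iff, Real.norm_eq_abs, Real.norm_eq_abs,
    abs_of_pos hy.1]
  constructor
  · have := abs_sub_abs_le_abs_sub z.1 ((n + (l + 1 / 3)) / 3 ^ k)
    linarith
  · linarith [hy.2, cantorHeight_le_one hα k, abs_nonneg l]

theorem layerSum_cantorBlocks_eq_indicator (hα : 0 ≤ α) (hφ : Function.support φ ⊆ cantorBand α)
    (hn : n ∈ cantorIndices k) {x y : ℝ} (hx : |x - (l + 1 / 3)| < 1 / 3)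
    (hy : y ∈ heightBand (cantorHeight α) (cantorBand α) k) :
    layerSum (cantorBlocks l) (cantorHeight α) a φ ((n + x) / 3 ^ k, y) =
      (Iio ((n + (l + 1 / 3)) / 3 ^ k)).indicator (fun _ => a k * φ (y / cantorHeight α k))
        ((n + x) / 3 ^ k) := by
  have hblock : (n + x) / 3 ^ k ∈ cantorBlocks l k ↔
      (n + x) / 3 ^ k ∈ Iio ((n + (l + 1 / 3)) / 3 ^ k) := by
    rw [mem_cantorBlocks_iff hn hx, mem_Iio, div_lt_div_iff_of_pos_right (by positivity),
      add_lt_add_iff_left]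
  rw [layerSum_eq_layerTerm (pairwise_disjoint_heightBand_cantorBand hα) hφ hy, layerTerm]
  classical simp only [indicator_apply, hblock]

/-- The cutoff on the horizontal neighbourhood of `cantorCell α l k n`; its derivative is supported
in the windows of `CantorAdapted`. -/
noncomputable def cantorBump (l : ℝ) (k n : ℕ) : ContDiffBump ((n + (l + 1 / 3)) / 3 ^ k : ℝ) where
  rIn := 4 / 27 / 3 ^ k
  rOut := 5 / 27 / 3 ^ k
  rIn_pos := by positivity
  rIn_lt_rOut := by gcongr; norm_num

theorem CantorAdapted.eq_indicator_of_deriv_cantorBump_ne_zero (hΩ : CantorAdapted α l Ω)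
    (hα : 0 ≤ α) (hφ : Function.support φ ⊆ cantorBand α) {w : ℝ × ℝ → ℝ}
    (hw : w =ᵐ[volume.restrict Ω] layerSum (cantorBlocks l) (cantorHeight α) a φ)
    (hn : n ∈ cantorIndices k) :
    ∀ᵐ z, deriv (cantorBump l k n) z.1 ≠ 0 → φ (z.2 / cantorHeight α k) ≠ 0 →
      w z = (Iio ((n + (l + 1 / 3)) / 3 ^ k)).indicator
        (fun _ => a k * φ (z.2 / cantorHeight α k)) z.1 := by
  filter_upwards [(ae_restrict_iff' hΩ.measurableSet).1 hw] with ⟨x', y⟩ hz hx' hy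
  obtain ⟨x, rfl⟩ : ∃ x, x' = (n + x) / 3 ^ k := ⟨x' * 3 ^ k - n, by field_simp; ring⟩
  have hband : y ∈ heightBand (cantorHeight α) (cantorBand α) k := hφ hy
  have hx : |x - (l + 1 / 3)| ∈ Icc (4 / 27 : ℝ) (5 / 27) := by
    have h3 : (0 : ℝ) < 3 ^ k := by positivity
    have := dist_mem_Icc_of_deriv_contDiffBump_ne_zero hx'
    rwa [Real.dist_eq, ← sub_div, add_sub_add_left_eq_sub, abs_div, abs_of_pos h3, cantorBump,
      mem_Icc, div_le_div_iff_of_pos_right h3, div_le_div_iff_of_pos_right h3] at this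
  rw [hz (hΩ.window_subset k n hn x hx y hband)]
  exact layerSum_cantorBlocks_eq_indicator hα hφ hn (hx.2.trans_lt (by norm_num)) hband

theorem CantorAdapted.ofReal_le_setLIntegral_cantorCell (hΩ : CantorAdapted α l Ω) (hα : 0 ≤ α)
    (hφJ : tsupport φ ⊆ cantorBand α) (hφ : ContDiff ℝ ∞ φ) (hφc : HasCompactSupport φ)
    (hφ1 : ∀ y, |φ y| ≤ 1) {w : ℝ × ℝ → ℝ} {v : ℝ × ℝ → ℝ × ℝ}
    (hw : HasWeakGradientOn (Metric.ball 0 (|l| + 2)) w v)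
    (hwu : w =ᵐ[volume.restrict Ω] layerSum (cantorBlocks l) (cantorHeight α) a φ)
    (hn : n ∈ cantorIndices k) :
    ENNReal.ofReal (|a k| * cantorHeight α k * ∫ y, φ y ^ 2) ≤
      ∫⁻ z in cantorCell α l k n, ‖v z‖ₑ := by
  have hh := cantorHeight_pos α k
  have hsupp : Function.support φ ⊆ cantorBand α := (subset_tsupport φ).trans hφJ
  set ψ : ℝ → ℝ := fun y => φ (y / cantorHeight α k) with hψ
  have hψJ : tsupport ψ ⊆ heightBand (cantorHeight α) (cantorBand α) k :=
    (tsupport_comp_subset_preimage φ (continuous_id.div_const _)).trans (preimage_mono hφJ)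
  have hψc : HasCompactSupport ψ :=
    hφc.comp_isClosedEmbedding (Homeomorph.mulRight₀ _ (inv_ne_zero hh.ne')).isClosedEmbedding
  calc ENNReal.ofReal (|a k| * cantorHeight α k * ∫ y, φ y ^ 2)
      = ‖∫ y, a k * ψ y * ψ y‖ₑ := by
        simp only [mul_assoc, ← sq, integral_const_mul, hψ,
          Measure.integral_comp_div fun y => φ y ^ 2]
        rw [Real.enorm_eq_ofReal_abs, abs_mul, smul_eq_mul, abs_of_pos hh,
          abs_of_nonneg (mul_nonneg hh.le (integral_nonneg fun _ => sq_nonneg _))]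
    _ ≤ ∫⁻ z in Metric.ball _ (cantorBump l k n).rOut ×ˢ Function.support ψ, ‖v z‖ₑ :=
        enorm_integral_le_lintegral_of_jump hw (hφ.comp (contDiff_id.div_const _)) hψc
          (fun y => hφ1 _)
          ((prod_mono_right hψJ).trans (closedBall_prod_heightBand_subset_ball hα hn))
          (hΩ.eq_indicator_of_deriv_cantorBump_ne_zero hα hsupp hwu hn)
    _ ≤ ∫⁻ z in cantorCell α l k n, ‖v z‖ₑ :=
        lintegral_mono_set (prod_mono_right ((subset_tsupport ψ).trans hψJ))

theorem CantorAdapted.memLp_of_hasW1LocExtension_layerSum (hΩ : CantorAdapted α l Ω) (hα : 0 ≤ α)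
    (hφJ : tsupport φ ⊆ cantorBand α) (hφ : ContDiff ℝ ∞ φ) (hφc : HasCompactSupport φ)
    (hφ1 : ∀ y, |φ y| ≤ 1) (hφ0 : 0 < ∫ y, φ y ^ 2) {q : ℝ} (hq : 1 ≤ q)
    (h : HasW1LocExtension (ENNReal.ofReal q) Ω
      (layerSum (cantorBlocks l) (cantorHeight α) a φ)) :
    MemLp (fun k => a k * 3 ^ k) (ENNReal.ofReal q) (cantorLayerMeasure α) := by
  obtain ⟨w, hw, hwu⟩ := h
  obtain ⟨-, v, hv, hvq⟩ := hw (Metric.ball 0 (|l| + 2)) Metric.isOpen_ball Metric.isBounded_ball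
    (subset_univ _)
  set κ := ∫ y, φ y ^ 2
  have hcell (i : Σ k, cantorIndices k) : cantorCell α l i.1 i.2 ⊆ Metric.ball 0 (|l| + 2) :=
    (prod_mono_left Metric.ball_subset_closedBall).trans
      (closedBall_prod_heightBand_subset_ball hα i.2.2)
  have hlower (i : Σ k, cantorIndices k) :
      ENNReal.ofReal (|a i.1| * cantorHeight α i.1 * κ) ≤
        ∫⁻ z in cantorCell α l i.1 i.2, ‖v z‖ₑ ∂volume.restrict (Metric.ball 0 (|l| + 2)) := by
    rw [Measure.restrict_restrict_of_subset (hcell i)]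
    exact hΩ.ofReal_le_setLIntegral_cantorCell hα hφJ hφ hφc hφ1 hv hwu i.2.2
  have hsum : Summable fun i : Σ k, cantorIndices k => cantorHeight α i.1 / 3 ^ i.1 *
      (|a i.1| * cantorHeight α i.1 * κ / (cantorHeight α i.1 / 3 ^ i.1)) ^ q := by
    refine summable_of_le_setLIntegral hq (fun i => measurableSet_cantorCell α l i.1 i.2)
      (pairwise_disjoint_cantorCell hα l) (fun i => ?_) (fun i => ?_)
      (fun i => (Measure.restrict_apply_le _ _).trans (volume_cantorCell_le hα l i.1 i.2))
      hlower hvq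
    · have := cantorHeight_pos α i.1
      positivity
    · exact div_pos (cantorHeight_pos α i.1) (by positivity)
  rw [memLp_cantorLayerMeasure_iff (by linarith),
    ← summable_mul_left_iff (Real.rpow_pos_of_pos hφ0 q).ne']
  refine hsum.sigma.congr fun k => ?_
  have hh := cantorHeight_pos α k
  have hratio : |a k| * cantorHeight α k * κ / (cantorHeight α k / 3 ^ k) = κ * |a k * 3 ^ k| := by
    rw [abs_mul, abs_of_pos (by positivity : (0 : ℝ) < 3 ^ k)]
    field_simp
  simp only [hratio]
  rw [tsum_fintype, Finset.sum_const, Finset.card_univ, Fintype.card_coe, card_cantorIndices,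
    Real.mul_rpow hφ0.le (abs_nonneg _), cantorWeight, nsmul_eq_mul, Nat.cast_pow,
    Nat.cast_ofNat]
  ring

theorem exists_contDiff_tsupport_subset_cantorBand (hα : 0 < α) :
    ∃ φ : ℝ → ℝ, tsupport φ ⊆ cantorBand α ∧ ContDiff ℝ ∞ φ ∧ HasCompactSupport φ ∧
      (∀ y, |φ y| ≤ 1) ∧ 0 < ∫ y, φ y ^ 2 := by
  have hmem : cantorBand α ∈ 𝓝 ((1 / 40 : ℝ) ^ α) :=
    isOpen_Ioo.mem_nhds ⟨Real.rpow_lt_rpow (by norm_num) (by norm_num) hα,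
      Real.rpow_lt_rpow (by norm_num) (by norm_num) hα⟩
  obtain ⟨φ, hφJ, hφc, hφ, hrange, hone⟩ := exists_contDiff_tsupport_subset (n := ⊤) hmem
  refine ⟨φ, hφJ, hφ, hφc, fun y => ?_, ?_⟩
  · obtain ⟨h0, h1⟩ := hrange (mem_range_self y)
    rwa [abs_of_nonneg h0]
  · refine (hφ.continuous.pow 2).integral_pos_of_hasCompactSupport_nonneg_nonzero
      (x := (1 / 40 : ℝ) ^ α) ?_ (fun y => sq_nonneg _) (by rw [hone]; norm_num)
    exact hφc.comp_left (g := fun x : ℝ => x ^ 2) (by norm_num)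

theorem CantorAdapted.exists_memW1_not_hasW1LocExtension (hΩ : CantorAdapted α l Ω) (hα : 0 < α)
    {p : ℝ≥0∞} (hp : 1 ≤ p)
    (ha : MemLp (fun k => a k / cantorHeight α k) p (cantorLayerMeasure α)) {q : ℝ} (hq : 1 ≤ q)
    (ha' : ¬ MemLp (fun k => a k * 3 ^ k) (ENNReal.ofReal q) (cantorLayerMeasure α)) :
    ∃ u : ℝ × ℝ → ℝ, MemW1 p Ω u ∧ ¬ HasW1LocExtension (ENNReal.ofReal q) Ω u := by
  obtain ⟨φ, hφJ, hφ, hφc, hφ1, hφ0⟩ := exists_contDiff_tsupport_subset_cantorBand hα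
  refine ⟨layerSum (cantorBlocks l) (cantorHeight α) a φ, ?_, fun h =>
    ha' (hΩ.memLp_of_hasW1LocExtension_layerSum hα.le hφJ hφ hφc hφ1 hφ0 hq h)⟩
  refine memW1_layerSum hΩ.toLayerAdapted (pairwise_disjoint_heightBand_cantorBand hα.le)
    (fun k => (isOpen_cantorBlocks l k).measurableSet) measurableSet_Ioo (fun k => ?_)
    (fun k => ⟨cantorHeight_pos α k, cantorHeight_le_one hα.le k⟩) hφJ hφc
    (hφ.of_le (by exact_mod_cast le_top)) hp ha
  rw [Measure.volume_eq_prod, Measure.prod_prod, cantorLayerMeasure_singleton, cantorWeight,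
    ENNReal.ofReal_mul (by positivity)]
  exact mul_le_mul' (volume_cantorBlocks_le l k) (volume_heightBand_cantorBand_le hα.le k)

end Nonextension

theorem cantorDim_pos : 0 < cantorDim :=
  div_pos (Real.log_pos (by norm_num)) (Real.log_pos (by norm_num))

theorem cantorDim_lt_one : cantorDim < 1 :=
  (div_lt_one (Real.log_pos (by norm_num))).2 (Real.log_lt_log (by norm_num) (by norm_num))

theorem three_pow_rpow_cantorDim (k : ℕ) : ((3 : ℝ) ^ k) ^ cantorDim = 2 ^ k := by
  rw [← Real.rpow_natCast_mul (by norm_num), mul_comm, Real.rpow_mul_natCast (by norm_num),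
    cantorDim, Real.log_div_log, Real.rpow_logb] <;> norm_num

section PowerCoeff

variable {α γ d p : ℝ}

/-- The sequence `3 ^ (-γ k) (k + 1) ^ (-d)`. The second factor decides about summability at the
critical exponent `γ = 0`. -/
noncomputable def powerCoeff (γ d : ℝ) (k : ℕ) : ℝ := ((3 : ℝ) ^ k) ^ (-γ) * (k + 1) ^ (-d)

theorem powerCoeff_pos (γ d : ℝ) (k : ℕ) : 0 < powerCoeff γ d k := by
  unfold powerCoeff
  positivity

theorem powerCoeff_mul (γ d δ e : ℝ) (k : ℕ) :
    powerCoeff γ d k * powerCoeff δ e k = powerCoeff (γ + δ) (d + e) k := by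
  simp only [powerCoeff, neg_add]
  rw [mul_mul_mul_comm, ← Real.rpow_add (by positivity), ← Real.rpow_add (by positivity)]

theorem powerCoeff_rpow (γ d p : ℝ) (k : ℕ) :
    powerCoeff γ d k ^ p = powerCoeff (p * γ) (p * d) k := by
  simp only [powerCoeff]
  rw [Real.mul_rpow (by positivity) (by positivity), ← Real.rpow_mul (by positivity),
    ← Real.rpow_mul (by positivity), neg_mul_comm, neg_mul_comm, mul_comm γ, mul_comm d,
    neg_mul, neg_mul]

theorem powerCoeff_le_rpow (γ : ℝ) (hd : 0 ≤ d) (k : ℕ) :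
    powerCoeff γ d k ≤ ((3 : ℝ) ^ k) ^ (-γ) :=
  mul_le_of_le_one_right (by positivity)
    (Real.rpow_le_one_of_one_le_of_nonpos (by simp) (by linarith))

theorem powerCoeff_le_one (hγ : 0 ≤ γ) (hd : 0 ≤ d) (k : ℕ) : powerCoeff γ d k ≤ 1 :=
  (powerCoeff_le_rpow γ hd k).trans
    (Real.rpow_le_one_of_one_le_of_nonpos (one_le_pow₀ (by norm_num)) (by linarith))

theorem summable_powerCoeff (hγ : 0 < γ) (hd : 0 ≤ d) : Summable (powerCoeff γ d) := by
  have hgeom : Summable fun k : ℕ => ((3 : ℝ) ^ k) ^ (-γ) := by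
    refine (summable_geometric_of_lt_one (r := (3 : ℝ) ^ (-γ)) (by positivity)
      (Real.rpow_lt_one_of_one_lt_of_neg (by norm_num) (by linarith))).congr fun k => ?_
    rw [← Real.rpow_natCast_mul (by norm_num), mul_comm, Real.rpow_mul_natCast (by norm_num)]
  exact hgeom.of_nonneg_of_le (fun k => (powerCoeff_pos γ d k).le) (powerCoeff_le_rpow γ hd)

theorem summable_powerCoeff_zero_iff : Summable (powerCoeff 0 d) ↔ 1 < d := by
  rw [← Real.summable_nat_rpow_inv,
    ← summable_nat_add_iff (f := fun k : ℕ => ((k : ℝ) ^ d)⁻¹) 1]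
  refine summable_congr fun k => ?_
  rw [powerCoeff, neg_zero, Real.rpow_zero, one_mul, Real.rpow_neg (by positivity),
    Nat.cast_add_one]

theorem cantorWeight_eq_powerCoeff (α : ℝ) (k : ℕ) :
    cantorWeight α k = powerCoeff (1 + α - cantorDim) 0 k := by
  rw [cantorWeight, cantorHeight, powerCoeff, neg_zero, Real.rpow_zero, mul_one,
    ← three_pow_rpow_cantorDim, show -(1 + α - cantorDim) = cantorDim - 1 + -α by ring,
    Real.rpow_add (by positivity), Real.rpow_sub (by positivity), Real.rpow_one]

theorem powerCoeff_div_cantorHeight (γ d α : ℝ) (k : ℕ) :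
    powerCoeff γ d k / cantorHeight α k = powerCoeff (γ - α) d k := by
  rw [powerCoeff, powerCoeff, cantorHeight, mul_div_right_comm, ← Real.rpow_sub (by positivity),
    neg_sub_neg, neg_sub]

theorem powerCoeff_mul_three_pow (γ d : ℝ) (k : ℕ) :
    powerCoeff γ d k * 3 ^ k = powerCoeff (γ - 1) d k := by
  rw [powerCoeff, powerCoeff, mul_right_comm, neg_sub, sub_eq_neg_add,
    Real.rpow_add_one (by positivity)]

theorem memLp_powerCoeff_iff_summable (hp : 0 < p) :
    MemLp (powerCoeff γ d) (ENNReal.ofReal p) (cantorLayerMeasure α) ↔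
      Summable (powerCoeff (1 + α - cantorDim + p * γ) (p * d)) := by
  rw [memLp_cantorLayerMeasure_iff hp]
  refine summable_congr fun k => ?_
  rw [abs_of_pos (powerCoeff_pos γ d k), powerCoeff_rpow, cantorWeight_eq_powerCoeff,
    powerCoeff_mul, zero_add]

theorem isFiniteMeasure_cantorLayerMeasure (hα : cantorDim < 1 + α) :
    IsFiniteMeasure (cantorLayerMeasure α) := by
  have h : MemLp (fun _ => (1 : ℝ)) (ENNReal.ofReal 1) (cantorLayerMeasure α) := by
    rw [memLp_cantorLayerMeasure_iff one_pos]
    simpa [cantorWeight_eq_powerCoeff] using summable_powerCoeff (sub_pos.2 hα) le_rfl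
  exact ⟨by simpa [memLp_const_iff] using h⟩

end PowerCoeff

section Exponents

variable {α l p q : ℝ} {Ω : Set (ℝ × ℝ)}

theorem CantorAdapted.exists_memW1_not_hasW1LocExtension_of_memLp (hΩ : CantorAdapted α l Ω)
    (hα : 0 < α) {p : ℝ≥0∞} (hp : 1 ≤ p) (hq : 1 ≤ q)
    (h : MemLp (powerCoeff (1 - α - (1 + α - cantorDim) / q) q⁻¹) p (cantorLayerMeasure α)) :
    ∃ u, MemW1 p Ω u ∧ ¬ HasW1LocExtension (ENNReal.ofReal q) Ω u := by
  have hq0 : 0 < q := by linarith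
  refine hΩ.exists_memW1_not_hasW1LocExtension
    (a := powerCoeff (1 - (1 + α - cantorDim) / q) q⁻¹) hα hp ?_ hq ?_
  · simpa only [powerCoeff_div_cantorHeight, sub_right_comm] using h
  · have hcritical : 1 + α - cantorDim + q * (1 - (1 + α - cantorDim) / q - 1) = 0 := by
      field_simp
      ring
    simp only [powerCoeff_mul_three_pow]
    rw [memLp_powerCoeff_iff_summable hq0, hcritical, mul_inv_cancel₀ hq0.ne',
      summable_powerCoeff_zero_iff]
    exact lt_irrefl 1

theorem CantorAdapted.exists_memW1_not_hasW1LocExtension_of_le (hΩ : CantorAdapted α l Ω)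
    (hα : 0 < α) (hαs : α ≤ cantorDim / 2) {p : ℝ≥0∞} (hp : 1 ≤ p) :
    ∃ u, MemW1 p Ω u ∧ ¬ HasW1LocExtension 1 Ω u := by
  have := isFiniteMeasure_cantorLayerMeasure (α := α) (by linarith [cantorDim_lt_one])
  rw [← ENNReal.ofReal_one]
  refine hΩ.exists_memW1_not_hasW1LocExtension_of_memLp hα hp le_rfl
    (MemLp.of_bound .of_discrete 1 (.of_forall fun k => ?_))
  rw [Real.norm_of_nonneg (powerCoeff_pos _ _ k).le]
  exact powerCoeff_le_one (by linarith) (by norm_num) k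

theorem memLp_powerCoeff_of_mul_le (hα : cantorDim < 1 + α) (hα1 : α < 1)
    (hq : 0 < q) (hqp : q ≤ p)
    (h : (1 + α - cantorDim) * p ≤ q * (1 + α - cantorDim + (1 - α) * p)) :
    MemLp (powerCoeff (1 - α - (1 + α - cantorDim) / q) q⁻¹) (ENNReal.ofReal p)
      (cantorLayerMeasure α) := by
  set E := 1 + α - cantorDim
  have hE : 0 < E := sub_pos.2 hα
  have hp : 0 < p := hq.trans_le hqp
  have hexp : E + p * (1 - α - E / q) = (q * (E + (1 - α) * p) - E * p) / q := by
    field_simp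
    ring
  rw [memLp_powerCoeff_iff_summable hp, hexp]
  obtain heq | hlt := h.eq_or_lt
  · have hslope : 0 < q * ((1 - α) * p) := mul_pos hq (mul_pos (sub_pos.2 hα1) hp)
    have hqp' : q < p := lt_of_mul_lt_mul_left (by linarith) hE.le
    rw [heq, sub_self, zero_div, summable_powerCoeff_zero_iff, ← div_eq_mul_inv, one_lt_div hq]
    exact hqp'
  · exact summable_powerCoeff (div_pos (sub_pos.2 hlt) hq) (by positivity)

theorem CantorAdapted.exists_memW1_not_hasW1LocExtension_of_div_le (hΩ : CantorAdapted α l Ω)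
    (hα : 0 < α) (hα1 : α < 1) (hp : 1 ≤ p) (hq : 1 ≤ q)
    (h : (1 + α - cantorDim) * p / (1 + α - cantorDim + (1 - α) * p) ≤ q) :
    ∃ u, MemW1 (ENNReal.ofReal p) Ω u ∧ ¬ HasW1LocExtension (ENNReal.ofReal q) Ω u := by
  have hE : cantorDim < 1 + α := by linarith [cantorDim_lt_one]
  have hslope : 0 < (1 - α) * p := mul_pos (sub_pos.2 hα1) (by linarith)
  have hmin : 1 ≤ min q p := le_min hq hp
  have hle : (1 + α - cantorDim) * p ≤ min q p * (1 + α - cantorDim + (1 - α) * p) := by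
    rw [div_le_iff₀ (by linarith)] at h
    rw [min_mul_of_nonneg _ _ (by linarith), le_min_iff]
    exact ⟨h, by nlinarith⟩
  obtain ⟨u, hu, hext⟩ := hΩ.exists_memW1_not_hasW1LocExtension_of_memLp hα
    (ENNReal.one_le_ofReal.2 hp) hmin
    (memLp_powerCoeff_of_mul_le hE hα1 (by linarith) (min_le_right _ _) hle)
  exact ⟨u, hu, fun hq => hext (hq.mono (ENNReal.ofReal_le_ofReal (min_le_left _ _)))⟩

theorem mul_div_le_one_iff_le_div (hαs : cantorDim / 2 < α) (hα1 : α < 1) (hp : 0 ≤ p) :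
    (1 + α - cantorDim) * p / (1 + α - cantorDim + (1 - α) * p) ≤ 1 ↔
      p ≤ (1 + α - cantorDim) / (2 * α - cantorDim) := by
  have hslope : 0 ≤ (1 - α) * p := mul_nonneg (sub_pos.2 hα1).le hp
  rw [div_le_one (by linarith [cantorDim_lt_one, cantorDim_pos]), le_div_iff₀ (by linarith)]
  constructor <;> intro <;> linarith

end Exponents

theorem proposition1p2 :
    -- (1)
    (∀ α : ℝ, 0 < α → α ≤ Real.log 2 / (2 * Real.log 3) →
      ∀ p : ℝ≥0∞, 1 ≤ p →
        (∃ u : ℝ × ℝ → ℝ, MemW1 p (cantorLower α) u ∧ ¬ HasW1LocExtension 1 (cantorLower α) u) ∧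
        (∃ u : ℝ × ℝ → ℝ, MemW1 p (cantorUpper α) u ∧ ¬ HasW1LocExtension 1 (cantorUpper α) u)) ∧
    -- (2)
    (∀ α : ℝ, Real.log 2 / (2 * Real.log 3) < α → α < 1 →
      ∀ p : ℝ, 1 ≤ p → p ≤ (1 + α - cantorDim) / (2 * α - cantorDim) →
        (∃ u : ℝ × ℝ → ℝ, MemW1 (ENNReal.ofReal p) (cantorLower α) u ∧
          ¬ HasW1LocExtension 1 (cantorLower α) u) ∧
        (∃ u : ℝ × ℝ → ℝ, MemW1 (ENNReal.ofReal p) (cantorUpper α) u ∧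
          ¬ HasW1LocExtension 1 (cantorUpper α) u)) ∧
    -- (3)
    (∀ α : ℝ, Real.log 2 / (2 * Real.log 3) < α → α < 1 →
      ∀ p : ℝ, (1 + α - cantorDim) / (2 * α - cantorDim) < p →
      ∀ q : ℝ, ((1 + α - cantorDim) * p) / (1 + α - cantorDim + (1 - α) * p) ≤ q →
        (∃ u : ℝ × ℝ → ℝ, MemW1 (ENNReal.ofReal p) (cantorLower α) u ∧
          ¬ HasW1LocExtension (ENNReal.ofReal q) (cantorLower α) u) ∧
        (∃ u : ℝ × ℝ → ℝ, MemW1 (ENNReal.ofReal p) (cantorUpper α) u ∧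
          ¬ HasW1LocExtension (ENNReal.ofReal q) (cantorUpper α) u)) := by
  have hs : Real.log 2 / (2 * Real.log 3) = cantorDim / 2 := by
    rw [cantorDim, mul_comm, div_div]
  have hs0 := cantorDim_pos
  rw [hs]
  refine ⟨fun α hα hαs p hp => ?_, fun α hαs hα1 p hp hpc => ?_, fun α hαs hα1 p hpc q hq => ?_⟩
  · exact ⟨(cantorAdapted_cantorLower hα).exists_memW1_not_hasW1LocExtension_of_le hα hαs hp,
      (cantorAdapted_cantorUpper hα).exists_memW1_not_hasW1LocExtension_of_le hα hαs hp⟩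
  · have hα : 0 < α := by linarith
    have hq := (mul_div_le_one_iff_le_div hαs hα1 (by linarith)).2 hpc
    have exists_u {l Ω} (hΩ : CantorAdapted α l Ω) :=
      hΩ.exists_memW1_not_hasW1LocExtension_of_div_le hα hα1 hp le_rfl hq
    rw [← ENNReal.ofReal_one]
    exact ⟨exists_u (cantorAdapted_cantorLower hα), exists_u (cantorAdapted_cantorUpper hα)⟩
  · have hα : 0 < α := by linarith
    have hp : 1 < p := ((one_lt_div (by linarith)).2 (by linarith)).trans hpc
    have hq1 : 1 < q := lt_of_not_ge fun hq1 =>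
      hpc.not_ge ((mul_div_le_one_iff_le_div hαs hα1 (by linarith)).1 (hq.trans hq1))
    have exists_u {l Ω} (hΩ : CantorAdapted α l Ω) :=
      hΩ.exists_memW1_not_hasW1LocExtension_of_div_le hα hα1 hp.le hq1.le hq
    exact ⟨exists_u (cantorAdapted_cantorLower hα), exists_u (cantorAdapted_cantorUpper hα)⟩
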